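/- A finite state machine (FSM) $\mathbf S=(S,I,O,h)$ consists of a finite set $S$ of states, finite non-empty disjoint sets $I$, $O$ of inputs and outputs, and a transition relation $h\subseteq S\times I\times O\times S$. An input $i$ is defined at $s$ if $(s,i,o,s')\in h$ for some $o,s'$; a state with no defined input is a deadlock state. $\mathbf S$ is complete if every input is defined at every state, observable if $(s,i,o,s_1),(s,i,o,s_2)\in h$ implies $s_1=s_2$, single-input if at most one input is defined at each state, and output-complete if, whenever $i$ is defined at $s$, there is for each $o\in O$ a transition $(s,i,o,s')\in h$. For a sequence $\gamma$ of input/output pairs, the $\gamma$-successor of $s$ is the set of the states reached from $s$ along paths labelled by $\gamma$ (empty if there are none). A test case over $I,O$ is a single-input, output-complete, observable FSM $\mathbf P$ with inputs $I$, outputs $O$ and an initial state from which all its states are reachable, whose transition diagram has no cycles. A test case $\mathbf P$ is a homing test case for $\mathbf S$ if for each trace $\gamma$ of $\mathbf P$ from its initial state to a deadlock state there is a state $s$ of $\mathbf S$ such that for every state $s'$ of $\mathbf S$ the $\gamma$-successor of $s'$ is empty or equal to $\{s\}$. **Proposition 5.** The problem of checking the existence of a homing test case for a complete observable (possibly nondeterministic)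 FSM is in P. Precisely: encode an FSM with states, inputs and outputs numbered $1,\dots,n$; $1,\dots,m$; $1,\dots,k$ as the binary word $1^n0\,1^m0\,1^k0\,T$, where $T$ lists the $n\cdot m\cdot k\cdot n$ bits of the characteristic table of $h$ in lexicographic order of $(s,i,o,s')$. Then the language of the codes of all complete observable FSMs that have a homing test case is decided by a (multi-stack) Turing machine in time polynomial in the length of the input word. Moreover, for every polynomial $q$ there is a polynomial $r$ such that the same machine, on the code of a complete observable FSM with $n$ states and at most $q(n)$ inputs and at most $q(n)$ outputs, answers correctly whether a homing test case exists after at most $r(n)$ steps. -/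

import Mathlib

/-- A finite state machine with states `S`, inputs `I` and outputs `O`, given by its transition
relation; finiteness of `S`, `I`, `O` and non-emptiness of `I`, `O` are required where machines
are quantified over.  Inputs and outputs are distinct types, hence disjoint. -/
structure FSM (S I O : Type*) where
  /-- `trans s i o s'` says that `(s, i, o, s')` is a transition. -/
  trans : S → I → O → S → Prop

namespace FSM

variable {S I O : Type*}

/-- The input `i` is defined at the state `s`. -/
def DefinedAt (M : FSM S I O) (s : S) (i : I) : Prop :=
  ∃ o s', M.trans s i o s'

/-- Every input is defined at every state. -/
def Complete (M : FSM S I O) : Prop :=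
  ∀ s i, M.DefinedAt s i

/-- State, input and output determine the next state. -/
def Observable (M : FSM S I O) : Prop :=
  ∀ s i o s₁ s₂, M.trans s i o s₁ → M.trans s i o s₂ → s₁ = s₂

/-- At each state at most one input is defined. -/
def SingleInput (M : FSM S I O) : Prop :=
  ∀ s i₁ i₂, M.DefinedAt s i₁ → M.DefinedAt s i₂ → i₁ = i₂

/-- Each input defined at a state admits there a transition for every output. -/
def OutputComplete (M : FSM S I O) : Prop :=
  ∀ s i, M.DefinedAt s i → ∀ o, ∃ s', M.trans s i o s'

/-- `M.Reaches s γ t`: the sequence `γ` of input/output pairs labels a path from `s` to `t`. -/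
def Reaches (M : FSM S I O) : S → List (I × O) → S → Prop
  | s, [], t => s = t
  | s, io :: γ, t => ∃ u, M.trans s io.1 io.2 u ∧ M.Reaches u γ t

/-- The `γ`-successor of a state (the empty set if `γ` is not a trace at `s`). -/
def successor (M : FSM S I O) (s : S) (γ : List (I × O)) : Set S :=
  {t | M.Reaches s γ t}

/-- A deadlock state: no input is defined there. -/
def Deadlock (M : FSM S I O) (s : S) : Prop :=
  ∀ i, ¬ M.DefinedAt s i

/-- The edge relation of the transition diagram. -/
def Edge (M : FSM S I O) (s t : S) : Prop :=
  ∃ i o, M.trans s i o t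

/-- The transition diagram has no cycles. -/
def Acyclic (M : FSM S I O) : Prop :=
  ∀ s, ¬ Relation.TransGen M.Edge s s

/-- Every state is reachable from `s₀`. -/
def InitiallyConnected (M : FSM S I O) (s₀ : S) : Prop :=
  ∀ s, Relation.ReflTransGen M.Edge s₀ s

/-- The machine `P` initialized at `p₀` is a test case. -/
structure IsTestCase {Q : Type*} (P : FSM Q I O) (p₀ : Q) : Prop where
  finite : Finite Q
  initiallyConnected : P.InitiallyConnected p₀
  singleInput : P.SingleInput
  outputComplete : P.OutputComplete
  observable : P.Observable
  acyclic : P.Acyclic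

/-- The machine `P` initialized at `p₀` is homing for the set `A` of states of `M`. -/
def IsHomingFor {Q : Type*} (P : FSM Q I O) (p₀ : Q) (M : FSM S I O) (A : Set S) : Prop :=
  ∀ γ d, P.Reaches p₀ γ d → P.Deadlock d →
    ∃ s, ∀ s' ∈ A, M.successor s' γ = ∅ ∨ M.successor s' γ = {s}

/-- The set `A` of states is adaptively homing: some test case is homing for it. -/
def HomingSet (M : FSM S I O) (A : Set S) : Prop :=
  ∃ (Q : Type) (P : FSM Q I O) (p₀ : Q), P.IsTestCase p₀ ∧ P.IsHomingFor p₀ M A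

/-- The machine is adaptively homing: some test case is homing for the set of all its states. -/
def AdaptivelyHoming (M : FSM S I O) : Prop :=
  M.HomingSet Set.univ

open Classical in
/-- The binary code of a machine with `n` states, `m` inputs and `k` outputs: the numbers
`n`, `m`, `k` in unary, each closed by a `0`, followed by the `n * m * k * n` bits of the
characteristic table of the transition relation. -/
noncomputable def code {n m k : ℕ} (M : FSM (Fin n) (Fin m) (Fin k)) : List Bool :=
  List.replicate n true ++ [false] ++
  (List.replicate m true ++ [false]) ++
  (List.replicate k true ++ [false]) ++
  (List.finRange n).flatMap fun s =>
    (List.finRange m).flatMap fun i =>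
      (List.finRange k).flatMap fun o =>
        (List.finRange n).map fun s' => decide (M.trans s i o s')

/-- The adaptive homing problem as a language: the codes of the complete observable machines
that have a homing test case. -/
def adaptiveHomingLanguage : Set (List Bool) :=
  {w | ∃ (n m k : ℕ) (M : FSM (Fin n) (Fin m) (Fin k)), 0 < m ∧ 0 < k ∧
    M.Complete ∧ M.Observable ∧ M.AdaptivelyHoming ∧ M.code = w}

end FSM

open Classical in
/-- Polynomial-time deciders of a language: Turing machines that, on every binary word `w`, halt
after at most polynomially many steps in the length of `w`, with the one-bit output telling
whether `w` belongs to `L`.  The language `L` is in the class P if and only if there is one. -/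
abbrev PolyTimeDecider (L : Set (List Bool)) : Type 1 :=
  Turing.TM2ComputableInPolyTime (id : List Bool → List Bool) Computability.encodeBool
    (fun w => decide (w ∈ L))

open Classical in
/-- The machine `A`, started on the binary word `w`, halts after at most `t` steps with the
one-bit output telling whether the proposition `p` holds. -/
def AnswersInTime (A : Turing.TM2ComputableAux Bool Bool) (w : List Bool) (p : Prop) (t : ℕ) :
    Prop :=
  Nonempty (Turing.TM2OutputsInTime A.tm (w.map A.inputAlphabet.invFun)
    (some ((Computability.encodeBool (decide p)).map A.outputAlphabet.invFun)) t)

/-! A complete observable machine with at least one state has a homing test case if and only if each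
pair of its states can be homed (`FSM.adaptivelyHoming_iff`). One direction is clear, as a test case
for all states homes every pair. Conversely, keep track of the set of states that are still
possible, choose two distinct members and follow an experiment for this pair. By observability the
set never grows; and when the two states merge, or one of them cannot give the observed answer, the
set has lost a state. Repeating this leaves at most one state.

The homing pairs form the least relation that contains the diagonal and each pair for which some
input leads, under every output, to pairs in the relation only. Since there are n² pairs, n² rounds
of marking suffice (`stage_iff_pairHoming`). So membership in the language becomes a conjunction of
conditions with bounded quantifiers on the parsed word (`mem_adaptiveHomingLanguage_iff`), and these
are evaluated by nested loops.

It remains to run the loops on a multi-stack machine. Structured programs have a big-step semantics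
with step counts, which their compiled code reproduces step by step (`Exec.iterate_step`). Numbers
are kept in unary, tables are accessed by shifting bits to an auxiliary stack, and `Triple` is a
Hoare triple for total correctness whose time bound is a polynomial in a number N bounding the
heights of the stacks. The nesting depth of the loops is fixed, so the bounds remain polynomial, and
N = (|w| + 1)³ works for every word w (`isBound`).

The last claim of the theorem holds because the length of the code is polynomial in n if the numbers
of inputs and outputs are, and because the code determines the machine (`code_mem_iff`). -/

/-- Structured programs acting on stacks of bits indexed by `K` and an internal state in `σ`. -/
inductive StackProg (K σ : Type) : Type
  | push (k : K) (f : σ → Bool)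
  | pop (k : K) (f : σ → Option Bool → σ)
  | peek (k : K) (f : σ → Option Bool → σ)
  | load (f : σ → σ)
  | seq (p q : StackProg K σ)
  | ite (c : σ → Bool) (p q : StackProg K σ)
  | loop (c : σ → Bool) (p : StackProg K σ)

/-! ### Structured programs and their compilation to multi-stack machines -/

namespace StackProg

open Turing Function

variable {K σ : Type}

/-- The labels of the machine running a program. -/
def Label : StackProg K σ → Type
  | push _ _ => Unit
  | pop _ _ => Unit
  | peek _ _ => Unit
  | load _ => Unit
  | seq p q => p.Label ⊕ q.Label
  | ite _ p q => Option (p.Label ⊕ q.Label)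
  | loop _ p => Option p.Label

/-- A program has finitely many labels. -/
@[reducible]
def labelFintype : (p : StackProg K σ) → Fintype p.Label
  | push _ _ => inferInstanceAs (Fintype Unit)
  | pop _ _ => inferInstanceAs (Fintype Unit)
  | peek _ _ => inferInstanceAs (Fintype Unit)
  | load _ => inferInstanceAs (Fintype Unit)
  | seq p q =>
    letI := p.labelFintype
    letI := q.labelFintype
    inferInstanceAs (Fintype (p.Label ⊕ q.Label))
  | ite _ p q =>
    letI := p.labelFintype
    letI := q.labelFintype
    inferInstanceAs (Fintype (Option (p.Label ⊕ q.Label)))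
  | loop _ p =>
    letI := p.labelFintype
    inferInstanceAs (Fintype (Option p.Label))

/-- The label at which a program starts. -/
def entry : (p : StackProg K σ) → p.Label
  | push _ _ => ()
  | pop _ _ => ()
  | peek _ _ => ()
  | load _ => ()
  | seq p _ => Sum.inl p.entry
  | ite _ _ _ => none
  | loop _ _ => none

/-- The machine code of a program whose labels are embedded by `e` into the labels of a larger
machine and which continues at the label `next`. -/
def stmt {Λ : Type} : (p : StackProg K σ) → (p.Label → Λ) → Λ → p.Label →
    TM2.Stmt (fun _ : K => Bool) Λ σ
  | push k f, _, next, _ => .push k f (.goto fun _ => next)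
  | pop k f, _, next, _ => .pop k f (.goto fun _ => next)
  | peek k f, _, next, _ => .peek k f (.goto fun _ => next)
  | load f, _, next, _ => .load f (.goto fun _ => next)
  | seq p q, e, _, Sum.inl l => p.stmt (fun l => e (Sum.inl l)) (e (Sum.inr q.entry)) l
  | seq _ q, e, next, Sum.inr l => q.stmt (fun l => e (Sum.inr l)) next l
  | ite c p q, e, _, none =>
    .branch c (.goto fun _ => e (some (Sum.inl p.entry)))
      (.goto fun _ => e (some (Sum.inr q.entry)))
  | ite _ p _, e, next, some (Sum.inl l) => p.stmt (fun l => e (some (Sum.inl l))) next l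
  | ite _ _ q, e, next, some (Sum.inr l) => q.stmt (fun l => e (some (Sum.inr l))) next l
  | loop c p, e, next, none =>
    .branch c (.goto fun _ => e (some p.entry)) (.goto fun _ => next)
  | loop _ p, e, _, some l => p.stmt (fun l => e (some l)) (e none) l

variable [DecidableEq K]

/-- `Exec p a t b`: started in the memory `a`, the program `p` ends in the memory `b` after
exactly `t` steps. -/
inductive Exec : StackProg K σ → σ × (K → List Bool) → ℕ → σ × (K → List Bool) → Prop
  | push {k f v S} : Exec (push k f) (v, S) 1 (v, update S k (f v :: S k))
  | pop {k f v S} : Exec (pop k f) (v, S) 1 (f v (S k).head?, update S k (S k).tail)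
  | peek {k f v S} : Exec (peek k f) (v, S) 1 (f v (S k).head?, S)
  | load {f v S} : Exec (load f) (v, S) 1 (f v, S)
  | seq {p q a b c t u} : Exec p a t b → Exec q b u c → Exec (seq p q) a (t + u) c
  | ite_true {c p q a b t} : c a.1 = true → Exec p a t b → Exec (ite c p q) a (1 + t) b
  | ite_false {c p q a b t} : c a.1 = false → Exec q a t b → Exec (ite c p q) a (1 + t) b
  | loop_true {c p a b b' t u} : c a.1 = true → Exec p a t b → Exec (loop c p) b u b' →
      Exec (loop c p) a (1 + t + u) b'
  | loop_false {c p a} : c a.1 = false → Exec (loop c p) a 1 a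

/-- One step of a machine, on configurations that may be undefined. -/
def stepOption {Λ : Type} (m : Λ → TM2.Stmt (fun _ : K => Bool) Λ σ) :
    Option (TM2.Cfg (fun _ : K => Bool) Λ σ) → Option (TM2.Cfg (fun _ : K => Bool) Λ σ) :=
  flip bind (TM2.step m)

/-- Each label costs one machine step, so the count `t` of the big-step semantics is the number of
iterations. The embedding `e` and the exit `next` vary in the induction: a loop body has the loop
head as its exit, and the first part of a sequence has the entry of the second. -/
theorem Exec.iterate_step {p : StackProg K σ} {a b : σ × (K → List Bool)} {t : ℕ}
    (h : Exec p a t b) {Λ : Type} (m : Λ → TM2.Stmt (fun _ : K => Bool) Λ σ) (e : p.Label → Λ)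
    (next : Λ) (hm : ∀ l, m (e l) = p.stmt e next l) :
    (stepOption m)^[t] (some ⟨some (e p.entry), a.1, a.2⟩) = some ⟨some next, b.1, b.2⟩ := by
  induction h generalizing next with
  | push => simp [stepOption, flip, TM2.step, hm, stmt, TM2.stepAux]
  | pop => simp [stepOption, flip, TM2.step, hm, stmt, TM2.stepAux]
  | peek => simp [stepOption, flip, TM2.step, hm, stmt, TM2.stepAux]
  | load => simp [stepOption, flip, TM2.step, hm, stmt, TM2.stepAux]
  | @seq p q a b c t u _ _ ihp ihq =>
    rw [add_comm, iterate_add_apply]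
    have h1 := ihp (fun l => e (Sum.inl l)) (e (Sum.inr q.entry)) (fun l => hm (Sum.inl l))
    have h2 := ihq (fun l => e (Sum.inr l)) next (fun l => hm (Sum.inr l))
    exact (congrArg _ h1).trans h2
  | @ite_true c p q a b t hc _ ih =>
    rw [add_comm, iterate_add_apply]
    have h1 := ih (fun l => e (some (Sum.inl l))) next (fun l => hm (some (Sum.inl l)))
    refine Eq.trans (congrArg _ ?_) h1
    have := hm none
    simp only [stmt] at this
    simp [stepOption, flip, TM2.step, entry, this, TM2.stepAux, hc]
  | @ite_false c p q a b t hc _ ih =>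
    rw [add_comm, iterate_add_apply]
    have h1 := ih (fun l => e (some (Sum.inr l))) next (fun l => hm (some (Sum.inr l)))
    refine Eq.trans (congrArg _ ?_) h1
    have := hm none
    simp only [stmt] at this
    simp [stepOption, flip, TM2.step, entry, this, TM2.stepAux, hc]
  | @loop_true c p a b b' t u hc _ _ ih ih' =>
    rw [add_comm, iterate_add_apply, add_comm 1 t, iterate_add_apply]
    have h1 := ih (fun l => e (some l)) (e none) (fun l => hm (some l))
    have h2 := ih' e next hm
    refine Eq.trans (congrArg _ ?_) h2
    refine Eq.trans (congrArg _ ?_) h1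
    have := hm none
    simp only [stmt] at this
    simp [stepOption, flip, TM2.step, entry, this, TM2.stepAux, hc]
  | @loop_false c p a hc =>
    have := hm none
    simp only [stmt] at this
    simp [stepOption, flip, TM2.step, entry, this, TM2.stepAux, hc]

/-- Started in the memory `a`, the program `p` ends in the memory `b` after at most `T` steps. -/
def Runs (p : StackProg K σ) (a : σ × (K → List Bool)) (T : ℕ) (b : σ × (K → List Bool)) : Prop :=
  ∃ t ≤ T, Exec p a t b

namespace Runs

variable {p q : StackProg K σ} {a b c : σ × (K → List Bool)} {T U : ℕ}

theorem mono (h : Runs p a T b) (hTU : T ≤ U) : Runs p a U b := by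
  obtain ⟨t, ht, h⟩ := h
  exact ⟨t, ht.trans hTU, h⟩

theorem of_eq (h : Runs p a T b) (hb : b = c) (hTU : T ≤ U) : Runs p a U c :=
  hb ▸ h.mono hTU

theorem push (k : K) (f : σ → Bool) (v : σ) (S : K → List Bool) :
    Runs (push k f) (v, S) 1 (v, update S k (f v :: S k)) :=
  ⟨1, le_rfl, .push⟩

theorem pop (k : K) (f : σ → Option Bool → σ) (v : σ) (S : K → List Bool) :
    Runs (pop k f) (v, S) 1 (f v (S k).head?, update S k (S k).tail) :=
  ⟨1, le_rfl, .pop⟩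

theorem peek (k : K) (f : σ → Option Bool → σ) (v : σ) (S : K → List Bool) :
    Runs (peek k f) (v, S) 1 (f v (S k).head?, S) :=
  ⟨1, le_rfl, .peek⟩

theorem load (f : σ → σ) (v : σ) (S : K → List Bool) : Runs (load f) (v, S) 1 (f v, S) :=
  ⟨1, le_rfl, .load⟩

theorem seq (hp : Runs p a T b) (hq : Runs q b U c) : Runs (seq p q) a (T + U) c := by
  obtain ⟨t, ht, hp⟩ := hp
  obtain ⟨u, hu, hq⟩ := hq
  exact ⟨t + u, by omega, .seq hp hq⟩

theorem ite_true {f : σ → Bool} (hf : f a.1 = true) (hp : Runs p a T b) :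
    Runs (ite f p q) a (T + 1) b := by
  obtain ⟨t, ht, hp⟩ := hp
  exact ⟨1 + t, by omega, .ite_true hf hp⟩

theorem ite_false {f : σ → Bool} (hf : f a.1 = false) (hq : Runs q a T b) :
    Runs (ite f p q) a (T + 1) b := by
  obtain ⟨t, ht, hq⟩ := hq
  exact ⟨1 + t, by omega, .ite_false hf hq⟩

theorem loop_true {f : σ → Bool} (hf : f a.1 = true) (hp : Runs p a T b)
    (hq : Runs (StackProg.loop f p) b U c) : Runs (StackProg.loop f p) a (T + 1 + U) c := by
  obtain ⟨t, ht, hp⟩ := hp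
  obtain ⟨u, hu, hq⟩ := hq
  exact ⟨1 + t + u, by omega, .loop_true hf hp hq⟩

theorem loop_false {f : σ → Bool} (hf : f a.1 = false) : Runs (StackProg.loop f p) a 1 a :=
  ⟨1, le_rfl, .loop_false hf⟩

end Runs

/-- The machine that runs a program and halts. -/
def machine [Fintype K] [Fintype σ] (p : StackProg K σ) (k₀ k₁ : K) (v₀ : σ) : FinTM2 :=
  letI := p.labelFintype
  { K := K
    k₀ := k₀
    k₁ := k₁
    Γ := fun _ => Bool
    Λ := Option p.Label
    main := some p.entry
    ΛFin := inferInstanceAs (Fintype (Option p.Label))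
    σ := σ
    initialState := v₀
    Γk₀Fin := inferInstanceAs (Fintype Bool)
    m := fun l => match l with
      | none => .halt
      | some l => p.stmt some none l }

/-- The additional step executes the halting label `none`. An output configuration prescribes the
internal state and all stacks, so the program has to restore `v₀` and to leave every stack except
`k₁` empty. -/
theorem Runs.outputsInTime [Fintype K] [Fintype σ] {p : StackProg K σ} {k₀ k₁ : K} {v₀ : σ}
    {w w' : List Bool} {T : ℕ}
    (h : Runs p (v₀, update (fun _ => []) k₀ w) T (v₀, update (fun _ => []) k₁ w')) :
    Nonempty (TM2OutputsInTime (p.machine k₀ k₁ v₀) w (some w') (T + 1)) := by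
  obtain ⟨t, ht, h⟩ := h
  have key := h.iterate_step (p.machine k₀ k₁ v₀).m some none (fun l => rfl)
  have hstk (k' : K) (u : List Bool) (k : K) (h : k = k' → List Bool = List Bool) :
      (if hk : k = k' then (h hk).mpr u else []) = update (fun _ => []) k' u k := by
    by_cases hk : k = k'
    · rw [dif_pos hk, hk, update_self]
      rfl
    · rw [dif_neg hk, update_of_ne hk]
  have hinit : initList (p.machine k₀ k₁ v₀) w =
      ⟨some (some p.entry), v₀, update (fun _ => []) k₀ w⟩ :=
    congrArg _ (funext fun k => hstk k₀ w k fun _ => rfl)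
  have hhalt : haltList (p.machine k₀ k₁ v₀) w' =
      ⟨none, v₀, update (fun _ => []) k₁ w'⟩ :=
    congrArg _ (funext fun k => hstk k₁ w' k fun _ => rfl)
  refine ⟨{ steps := t + 1, evals_in_steps := ?_, steps_le_m := Nat.succ_le_succ ht }⟩
  rw [hinit, add_comm, iterate_add_apply]
  refine Eq.trans ?_ (congrArg some hhalt).symm
  exact (congrArg _ key).trans rfl

end StackProg

/-! ### The stacks and registers of the decider -/

namespace HomingMachine

open Function Polynomial StackProg Turing

/-- The loop variables: `s`, `t`, `u`, `v` range over states, `i` over inputs, `o` over outputs,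
and `a`, `b` count rounds. -/
inductive Var
  | s | t | u | v | i | o | a | b
  deriving DecidableEq

instance : Fintype Var :=
  ⟨{.s, .t, .u, .v, .i, .o, .a, .b}, fun x => by cases x <;> decide⟩

/-- The stacks holding data: the input, which becomes the transition table, the output, a table
of pairs of states, auxiliary stacks, and the strides `1`, `n`, `k * n`, `m * (k * n)` of the
tables in unary. -/
inductive Dat
  | inp | out | tab | aux | tmp₁ | tmp₂ | one | strideO | strideI | strideS
  deriving DecidableEq

instance : Fintype Dat :=
  ⟨{.inp, .out, .tab, .aux, .tmp₁, .tmp₂, .one, .strideO, .strideI, .strideS},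
    fun x => by cases x <;> decide⟩

/-- The boolean registers. -/
inductive Flag
  | ok | ex | all | r₁ | r₂ | r₃
  deriving DecidableEq

instance : Fintype Flag :=
  ⟨{.ok, .ex, .all, .r₁, .r₂, .r₃}, fun x => by cases x <;> decide⟩

/-- The stacks: the value of a loop variable `x` is stored in unary on `lo x`, and what it lacks
to its bound on `hi x`. -/
inductive Stack
  | lo (x : Var) | hi (x : Var) | dat (k : Dat)
  deriving DecidableEq, Fintype

/-- The internal state: the bit read last and the boolean registers. -/
abbrev Reg := Option Bool × (Flag → Bool)

/-- Programs of the homing machine. -/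
abbrev Prog := StackProg Stack Reg

/-! ### Moving stacks -/

/-- Pop a bit into the register. -/
def popTop (k : Stack) : Prog := .pop k fun v b => (b, v.2)

/-- Read a bit into the register. -/
def peekTop (k : Stack) : Prog := .peek k fun v b => (b, v.2)

/-- Push the bit in the register. -/
def pushTop (k : Stack) : Prog := .push k fun v => v.1.getD false

/-- Forget the bit in the register. -/
def clearTop : Prog := .load fun v => (none, v.2)

/-- The register holds a bit. -/
def hasTop (v : Reg) : Bool := v.1.isSome

/-- Move the content of the stack `a` to the stack `b`. -/
def pour (a b : Stack) : Prog :=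
  .seq (popTop a) (.loop hasTop (.seq (pushTop b) (popTop a)))

theorem runs_popTop (k : Stack) (c : Option Bool) (fl : Flag → Bool) (S : Stack → List Bool) :
    Runs (popTop k) ((c, fl), S) 1 (((S k).head?, fl), update S k (S k).tail) :=
  Runs.pop _ _ _ _

theorem runs_peekTop (k : Stack) (c : Option Bool) (fl : Flag → Bool) (S : Stack → List Bool) :
    Runs (peekTop k) ((c, fl), S) 1 (((S k).head?, fl), S) :=
  Runs.peek _ _ _ _

theorem runs_pushTop (k : Stack) (x : Bool) (fl : Flag → Bool) (S : Stack → List Bool) :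
    Runs (pushTop k) ((some x, fl), S) 1 ((some x, fl), update S k (x :: S k)) :=
  Runs.push _ _ _ _

theorem runs_clearTop (c : Option Bool) (fl : Flag → Bool) (S : Stack → List Bool) :
    Runs clearTop ((c, fl), S) 1 ((none, fl), S) :=
  Runs.load _ _ _

theorem runs_while_true {p : Prog} {x : Bool} {fl : Flag → Bool} {S : Stack → List Bool}
    {b c : Reg × (Stack → List Bool)} {T U : ℕ} (hp : Runs p ((some x, fl), S) T b)
    (h : Runs (.loop hasTop p) b U c) : Runs (.loop hasTop p) ((some x, fl), S) (T + 1 + U) c :=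
  Runs.loop_true rfl hp h

theorem runs_while_false (p : Prog) (fl : Flag → Bool) (S : Stack → List Bool) :
    Runs (.loop hasTop p) ((none, fl), S) 1 ((none, fl), S) :=
  Runs.loop_false rfl

theorem runs_pour_loop {a b : Stack} (hab : a ≠ b) (fl : Flag → Bool) (l : List Bool) :
    ∀ (S : Stack → List Bool) (x : Bool), S a = l →
      Runs (.loop hasTop (.seq (pushTop b) (popTop a))) ((some x, fl), S) (3 * l.length + 4)
        ((none, fl), update (update S a []) b (l.reverse ++ x :: S b)) := by
  induction l with
  | nil =>
    intro S x hS
    have h := (runs_pushTop b x fl S).seq (runs_popTop a _ _ _)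
    rw [update_of_ne hab, hS] at h
    refine (runs_while_true h (runs_while_false _ _ _)).of_eq ?_ le_rfl
    rw [update_comm hab]
    rfl
  | cons y l ih =>
    intro S x hS
    have h := (runs_pushTop b x fl S).seq (runs_popTop a _ _ _)
    rw [update_of_ne hab, hS] at h
    refine (runs_while_true h (ih _ y (by simp))).of_eq ?_ ?_
    · rw [List.tail_cons, update_idem, update_of_ne hab.symm, update_self, update_comm hab,
        update_idem, update_comm hab.symm, List.reverse_cons, List.append_assoc]
      rfl
    · simp only [List.length_cons]
      omega

theorem runs_pour {a b : Stack} (hab : a ≠ b) (c : Option Bool) (fl : Flag → Bool)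
    (S : Stack → List Bool) :
    Runs (pour a b) ((c, fl), S) (3 * (S a).length + 2)
      ((none, fl), update (update S a []) b ((S a).reverse ++ S b)) := by
  have h := runs_popTop a c fl S
  rcases hS : S a with _ | ⟨x, l⟩
  · rw [hS] at h
    refine (h.seq (runs_while_false _ _ _)).of_eq ?_ (by simp)
    rw [List.tail_nil, update_comm hab, List.reverse_nil, List.nil_append, update_eq_self]
  · rw [hS] at h
    refine (h.seq (runs_pour_loop hab fl l _ x (by simp))).of_eq ?_ ?_
    · rw [List.tail_cons, update_idem, update_of_ne hab.symm, List.reverse_cons, List.append_assoc]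
      rfl
    · simp only [List.length_cons]
      omega

/-- Execute `p` as many times as there are bits on the stack `y`, with the help of the stack
`z`. -/
def iter (y z : Stack) (p : Prog) : Prog :=
  .seq (popTop y) (.seq (.loop hasTop (.seq (pushTop z) (.seq p (popTop y)))) (pour z y))

/-- `G j` is the memory after `j` rounds, apart from `y` and `z`: these hold the remaining and the
finished rounds while the loop runs, so the body must work for any content of both. Of the 6 extra
steps per round, 3 are the push, the pop and the loop test, and 3 are due to the final pour, which
restores `y`. -/
theorem runs_iter {y z : Stack} (hyz : y ≠ z) {p : Prog} {fl : Flag → Bool}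
    {G : ℕ → Stack → List Bool} {c T : ℕ}
    (hp : ∀ j < c, ∀ a b t, Runs p ((t, fl), update (update (G j) y a) z b) T
      ((none, fl), update (update (G (j + 1)) y a) z b))
    (hy₀ : G 0 y = List.replicate c true) (hz₀ : G 0 z = [])
    (hy : G c y = List.replicate c true) (hz : G c z = []) (t : Option Bool) :
    Runs (iter y z p) ((t, fl), G 0) (c * (T + 6) + 4) ((none, fl), G c) := by
  have hloop : ∀ r j, j + r = c →
      Runs (.loop hasTop (.seq (pushTop z) (.seq p (popTop y))))
        (((List.replicate r true).head?, fl),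
          update (update (G j) y (List.replicate r true).tail) z (List.replicate j true))
        (r * (T + 3) + 1)
        ((none, fl), update (update (G c) y []) z (List.replicate c true)) := by
    intro r
    induction r with
    | zero =>
      intro j hj
      obtain rfl : j = c := by omega
      exact (runs_while_false _ _ _).mono (by omega)
    | succ r ih =>
      intro j hj
      have h₁ := runs_pushTop z true fl
        (update (update (G j) y (List.replicate r true)) z (List.replicate j true))
      rw [update_idem, update_self, ← List.replicate_succ] at h₁
      have h₂ := runs_popTop y none fl
        (update (update (G (j + 1)) y (List.replicate r true)) z (List.replicate (j + 1) true))
      rw [update_of_ne hyz, update_self, update_comm hyz.symm, update_idem] at h₂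
      refine (runs_while_true (h₁.seq ((hp j (by omega) _ _ _).seq h₂))
        (ih (j + 1) (by omega))).mono ?_
      ring_nf
      omega
  have h₁ := runs_popTop y t fl (G 0)
  have h₂ := hloop c 0 (by omega)
  rw [hy₀] at h₁
  have hz' : update (update (G 0) y (List.replicate c true).tail) z [] =
      update (G 0) y (List.replicate c true).tail := by
    rw [update_comm hyz, ← hz₀, update_eq_self]
  rw [List.replicate_zero, hz'] at h₂
  refine (h₁.seq (h₂.seq (runs_pour hyz.symm none fl _))).of_eq ?_ ?_
  · rw [update_self, update_idem, update_of_ne hyz, update_self, List.reverse_replicate,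
      List.append_nil, update_comm hyz.symm, update_idem, ← hy, update_eq_self, ← hz,
      update_eq_self]
  · rw [update_self, List.length_replicate]
    ring_nf
    omega

/-! ### Access to tables by unary indices -/

/-- Move one bit from the data stack `A` to the auxiliary stack. -/
def move (A : Dat) : Prog :=
  .seq (popTop (.dat A)) (.ite hasTop (.seq (pushTop (.dat .aux)) clearTop) clearTop)

/-- The effect of moving `j` bits. -/
def moved (A : Dat) (j : ℕ) (S : Stack → List Bool) : Stack → List Bool :=
  update (update S (.dat A) ((S (.dat A)).drop j)) (.dat .aux)
    (((S (.dat A)).take j).reverse ++ S (.dat .aux))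

theorem moved_zero (A : Dat) (S : Stack → List Bool) : moved A 0 S = S := by
  simp [moved]

theorem moved_moved {A : Dat} (hA : A ≠ .aux) (i j : ℕ) (S : Stack → List Bool) :
    moved A i (moved A j S) = moved A (j + i) S := by
  have hA' : Stack.dat A ≠ .dat .aux := by simpa using hA
  unfold moved
  rw [update_of_ne hA', update_self, update_self, update_comm hA'.symm, update_idem,
    update_idem, List.drop_drop, List.take_add, List.reverse_append, List.append_assoc]

theorem moved_of_ne {A : Dat} {k : Stack} (h : k ≠ .dat A) (h' : k ≠ .dat .aux) (j : ℕ)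
    (S : Stack → List Bool) : moved A j S k = S k := by
  unfold moved
  rw [update_of_ne h', update_of_ne h]

theorem moved_update {A : Dat} {k : Stack} (h : k ≠ .dat A) (h' : k ≠ .dat .aux) (j : ℕ)
    (S : Stack → List Bool) (l : List Bool) :
    moved A j (update S k l) = update (moved A j S) k l := by
  unfold moved
  rw [update_of_ne h.symm, update_of_ne h'.symm, update_comm h, update_comm h']

/-- On an empty stack nothing happens, which agrees with `drop` and `take` beyond the end of a list.
Reading a table therefore needs no range condition. -/
theorem runs_move {A : Dat} (hA : A ≠ .aux) (c : Option Bool) (fl : Flag → Bool)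
    (S : Stack → List Bool) : Runs (move A) ((c, fl), S) 4 ((none, fl), moved A 1 S) := by
  have hA' : Stack.dat .aux ≠ .dat A := by simpa using hA.symm
  have h := runs_popTop (.dat A) c fl S
  rcases hS : S (.dat A) with _ | ⟨x, l⟩
  · rw [hS] at h
    refine (h.seq (Runs.ite_false rfl (runs_clearTop _ _ _))).of_eq ?_ (by omega)
    simp [moved, hS, hA']
  · rw [hS] at h
    refine (h.seq (Runs.ite_true rfl ((runs_pushTop _ x _ _).seq (runs_clearTop _ _ _)))).of_eq
      ?_ (by omega)
    simp [moved, hS, hA']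

theorem runs_iter_move {A y z : Dat} (hA : A ≠ .aux) (hyA : y ≠ A) (hyaux : y ≠ .aux)
    (hyz : y ≠ z) (hzA : z ≠ A) (hzaux : z ≠ .aux) {S : Stack → List Bool} {c : ℕ}
    (hy : S (.dat y) = List.replicate c true) (hz : S (.dat z) = []) (t : Option Bool)
    (fl : Flag → Bool) :
    Runs (iter (.dat y) (.dat z) (move A)) ((t, fl), S) (c * 10 + 4)
      ((none, fl), moved A c S) := by
  have h := runs_iter (y := .dat y) (z := .dat z) (p := move A) (fl := fl)
    (G := fun j => moved A j S) (c := c) (T := 4) (by simpa using hyz) ?_ (by simpa [moved_zero])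
    (by simpa [moved_zero]) (by rw [moved_of_ne (by simpa) (by simpa), hy])
    (by rw [moved_of_ne (by simpa) (by simpa), hz]) t
  · simpa only [moved_zero] using h
  · intro j _ a b t
    have := runs_move hA t fl (update (update (moved A j S) (.dat y) a) (.dat z) b)
    rwa [moved_update (by simpa) (by simpa), moved_update (by simpa) (by simpa),
      moved_moved hA] at this

/-- Move bits of the data stack `A`: for each member `(x, y)` of the list as many as the product
of the numbers `x` and `y`. -/
def seek (A : Dat) : List (Var × Dat) → Prog
  | [] => clearTop
  | (x, y) :: l =>
    .seq (iter (.lo x) (.dat .tmp₁) (iter (.dat y) (.dat .tmp₂) (move A))) (seek A l)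

/-- The data stacks that can serve as strides in an access to the data stack `A`. -/
def IsStride (A y : Dat) : Prop := y ≠ A ∧ y ≠ .aux ∧ y ≠ .tmp₁ ∧ y ≠ .tmp₂

/-- The data stack `A` can be accessed in the memory `S`. -/
def Accessible (A : Dat) (S : Stack → List Bool) : Prop :=
  A ≠ .aux ∧ A ≠ .tmp₁ ∧ A ≠ .tmp₂ ∧ S (.dat .tmp₁) = [] ∧ S (.dat .tmp₂) = []

/-- An index is a sum of products of loop variables and strides. Two nested unary iterations realize
each product, with `.tmp₁` and `.tmp₂` as helper stacks, and successive shifts add up by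
`moved_moved`. -/
theorem runs_seek {A : Dat} {N : ℕ} (e : Var → ℕ) (c : Dat → ℕ) (fl : Flag → Bool)
    (l : List (Var × Dat)) :
    ∀ (S : Stack → List Bool) (t : Option Bool), Accessible A S →
      (∀ p ∈ l, IsStride A p.2 ∧ S (.lo p.1) = List.replicate (e p.1) true ∧
        S (.dat p.2) = List.replicate (c p.2) true ∧ e p.1 ≤ N ∧ c p.2 ≤ N) →
      Runs (seek A l) ((t, fl), S) (l.length * (N * (N * 10 + 10) + 4) + 1)
        ((none, fl), moved A (l.map fun p => e p.1 * c p.2).sum S) := by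
  induction l with
  | nil =>
    intro S t _ _
    rw [List.map_nil, List.sum_nil, moved_zero]
    exact (runs_clearTop t fl S).mono (by simp)
  | cons p l ih =>
    obtain ⟨x, y⟩ := p
    intro S t hS hl
    obtain ⟨hA, hA1, hA2, h1, h2⟩ := hS
    obtain ⟨⟨hyA, hya, hy1, hy2⟩, hlo, hdat, hx, hy⟩ := hl (x, y) (by simp)
    have hmul : c y ≤ N := hy
    have hfirst : Runs (iter (.lo x) (.dat .tmp₁) (iter (.dat y) (.dat .tmp₂) (move A)))
        ((t, fl), S) (N * (N * 10 + 10) + 4) ((none, fl), moved A (e x * c y) S) := by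
      have h := runs_iter (y := .lo x) (z := .dat .tmp₁)
        (p := iter (.dat y) (.dat .tmp₂) (move A)) (fl := fl)
        (G := fun j => moved A (j * c y) S) (c := e x) (T := N * 10 + 4) (by simp) ?_
        (by simpa [moved_zero]) (by simpa [moved_zero])
        (by rw [moved_of_ne (by simp) (by simp), hlo])
        (by rw [moved_of_ne (by simpa using hA1.symm) (by simp), h1]) t
      · simp only [zero_mul, moved_zero] at h
        exact h.mono (Nat.add_le_add_right (Nat.mul_le_mul_right _ hx) _)
      · intro j _ a b t
        have := runs_iter_move (A := A) (y := y) (z := .tmp₂) (c := c y) hA hyA hya hy2 hA2.symm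
          (by simp) (S := update (update (moved A (j * c y) S) (.lo x) a) (.dat .tmp₁) b)
          (by rw [update_of_ne (by simpa using hy1), update_of_ne (by simp),
            moved_of_ne (by simpa) (by simpa)]; exact hdat)
          (by rw [update_of_ne (by simp), update_of_ne (by simp),
            moved_of_ne (by simpa using hA2.symm) (by simp), h2]) t fl
        rw [moved_update (by simpa using hA1.symm) (by simp), moved_update (by simp) (by simp),
          moved_moved hA, ← Nat.succ_mul] at this
        exact this.mono (by omega)
    have hsecond := ih (moved A (e x * c y) S) none
      ⟨hA, hA1, hA2, by rw [moved_of_ne (by simpa using hA1.symm) (by simp), h1],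
        by rw [moved_of_ne (by simpa using hA2.symm) (by simp), h2]⟩ (by
        intro p hp
        obtain ⟨hst, hlo', hdat', hb⟩ := hl p (by simp [hp])
        refine ⟨hst, ?_, ?_, hb⟩
        · rw [moved_of_ne (by simp) (by simp), hlo']
        · rw [moved_of_ne (by simpa using hst.1) (by simpa using hst.2.1), hdat'])
    rw [moved_moved hA] at hsecond
    exact (hfirst.seq hsecond).mono (by simp only [List.length_cons]; ring_nf; omega)

/-- Read the bit of the data stack `A` at the given index into the register `r`. -/
def readAt (A : Dat) (l : List (Var × Dat)) (r : Flag) : Prog :=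
  .seq (seek A l) (.seq (peekTop (.dat A))
    (.seq (.load fun v => (none, update v.2 r (v.1.getD false))) (pour (.dat .aux) (.dat A))))

/-- Overwrite the bit of the data stack `A` at the given index by `true`. -/
def setAt (A : Dat) (l : List (Var × Dat)) : Prog :=
  .seq (seek A l) (.seq (popTop (.dat A))
    (.seq (.push (.dat A) fun _ => true) (pour (.dat .aux) (.dat A))))

section

variable {A : Dat} {N : ℕ} {e : Var → ℕ} {c : Dat → ℕ} {l : List (Var × Dat)}
  {S : Stack → List Bool}

/-- The skipped bits lie in reverse order on `.aux`, so pouring them back restores the table. Beyond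
the end of the table the register receives the default `false`. -/
theorem runs_readAt (hS : Accessible A S) (haux : S (.dat .aux) = [])
    (hl : ∀ p ∈ l, IsStride A p.2 ∧ S (.lo p.1) = List.replicate (e p.1) true ∧
        S (.dat p.2) = List.replicate (c p.2) true ∧ e p.1 ≤ N ∧ c p.2 ≤ N)
    (hA : (S (.dat A)).length ≤ N) (r : Flag) (fl : Flag → Bool) :
    Runs (readAt A l r) ((none, fl), S) (l.length * (N * (N * 10 + 10) + 4) + 3 * N + 5)
      ((none, update fl r ((S (.dat A)).getD (l.map fun p => e p.1 * c p.2).sum false)), S) := by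
  have hA' : Stack.dat A ≠ .dat .aux := by simpa using hS.1
  set j := (l.map fun p => e p.1 * c p.2).sum with hj
  have hload := Runs.load (fun v : Reg => (none, update v.2 r (v.1.getD false)))
    ((moved A j S (.dat A)).head?, fl) (moved A j S)
  refine ((runs_seek e c fl l S none hS hl).seq ((runs_peekTop (.dat A) _ _ _).seq
    (hload.seq (runs_pour hA'.symm _ _ _)))).of_eq ?_ ?_
  · have h₁ : (moved A j S (.dat A)).head?.getD false = (S (.dat A)).getD j false := by
      simp [moved, hA', List.getD_eq_getElem?_getD, List.head?_drop]
    rw [h₁]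
    refine Prod.ext rfl ?_
    simp only [moved, haux, List.append_nil]
    rw [update_self, update_of_ne hA', update_self, update_idem, update_comm hA', update_idem,
      List.reverse_reverse, List.take_append_drop, ← haux, update_comm hA'.symm, update_eq_self,
      update_eq_self]
  · have : (moved A j S (.dat .aux)).length ≤ N := by
      simp only [moved, haux, update_self, List.append_nil, List.length_reverse, List.length_take]
      omega
    omega

/-- Here the index must lie inside the table: otherwise the pop would remove nothing and the push
would lengthen the table. -/
theorem runs_setAt (hS : Accessible A S) (haux : S (.dat .aux) = [])
    (hl : ∀ p ∈ l, IsStride A p.2 ∧ S (.lo p.1) = List.replicate (e p.1) true ∧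
        S (.dat p.2) = List.replicate (c p.2) true ∧ e p.1 ≤ N ∧ c p.2 ≤ N)
    (hA : (S (.dat A)).length ≤ N)
    (hlt : (l.map fun p => e p.1 * c p.2).sum < (S (.dat A)).length) (fl : Flag → Bool) :
    Runs (setAt A l) ((none, fl), S) (l.length * (N * (N * 10 + 10) + 4) + 3 * N + 5)
      ((none, fl), update S (.dat A)
        ((S (.dat A)).set (l.map fun p => e p.1 * c p.2).sum true)) := by
  have hA' : Stack.dat A ≠ .dat .aux := by simpa using hS.1
  set j := (l.map fun p => e p.1 * c p.2).sum with hj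
  have hpush := Runs.push (.dat A) (fun _ => true) ((moved A j S (.dat A)).head?, fl)
    (update (moved A j S) (.dat A) (moved A j S (.dat A)).tail)
  refine ((runs_seek e c fl l S none hS hl).seq ((runs_popTop (.dat A) _ _ _).seq
    (hpush.seq (runs_pour hA'.symm _ _ _)))).of_eq ?_ ?_
  · rw [List.set_eq_take_cons_drop _ hlt]
    refine Prod.ext rfl ?_
    simp only [moved, haux, List.append_nil, update_self, update_idem, update_of_ne hA',
      update_of_ne hA'.symm, List.reverse_reverse, List.tail_drop]
    funext k
    simp only [update_apply]
    split_ifs <;> simp_all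
  · have : (moved A j S (.dat .aux)).length ≤ N := by
      simp only [moved, haux, update_self, List.append_nil, List.length_reverse, List.length_take]
      omega
    rw [update_of_ne hA'.symm, update_of_ne hA'.symm]
    omega

end

/-! ### Programs with time bounds, on memories with loop variables -/

/-- The boolean registers and the data stacks. -/
structure Mem where
  /-- the boolean registers -/
  flag : Flag → Bool
  /-- the data stacks -/
  dat : Dat → List Bool

/-- The stacks when the loop variables have bounds `d` and values `e` and the data stacks have the
content `D`. -/
def stk (d e : Var → ℕ) (D : Dat → List Bool) : Stack → List Bool
  | .lo x => List.replicate (e x) true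
  | .hi x => List.replicate (d x - e x) true
  | .dat k => D k

/-- The whole memory between two commands. -/
def conf (d e : Var → ℕ) (μ : Mem) : Reg × (Stack → List Bool) :=
  ((none, μ.flag), stk d e μ.dat)

theorem update_stk_dat (d e : Var → ℕ) (D : Dat → List Bool) (k : Dat) (l : List Bool) :
    update (stk d e D) (.dat k) l = stk d e (update D k l) := by
  funext j
  cases j with
  | lo x => simp [stk]
  | hi x => simp [stk]
  | dat j =>
    by_cases h : j = k
    · subst h
      simp [stk]
    · simp [stk, h]

/-- A program together with a bound of its running time by a polynomial in a number that bounds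
the heights of all stacks. -/
structure TimedProg where
  /-- the program -/
  prog : Prog
  /-- the bound of its running time -/
  bound : ℕ[X]

/-- From each memory with the property `P` the program `c` leads to one with the property `Q`
within its time bound at `N`, preserving the bounds `d` and the values `e` of the loop
variables. -/
def Triple (N : ℕ) (d e : Var → ℕ) (P : Mem → Prop) (c : TimedProg) (Q : Mem → Prop) : Prop :=
  ∀ μ, P μ → ∃ μ', Q μ' ∧ Runs c.prog (conf d e μ) (c.bound.eval N) (conf d e μ')

namespace TimedProg

/-- Sequential composition. -/
noncomputable def seq (c₁ c₂ : TimedProg) : TimedProg :=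
  ⟨.seq c₁.prog c₂.prog, c₁.bound + c₂.bound⟩

/-- Execute `c` for all values of the loop variable `x`. -/
noncomputable def forVar (x : Var) (c : TimedProg) : TimedProg :=
  ⟨.seq (peekTop (.hi x)) (.seq
    (.loop hasTop (.seq clearTop (.seq c.prog (.seq (popTop (.hi x))
      (.seq (.push (.lo x) fun _ => true) (peekTop (.hi x)))))))
    (pour (.lo x) (.hi x))), X * (c.bound + 8) + 4⟩

/-- Set the register `r` to the value of a function of the registers. -/
noncomputable def assign (r : Flag) (f : (Flag → Bool) → Bool) : TimedProg :=
  ⟨.load fun v => (v.1, update v.2 r (f v.2)), 1⟩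

/-- Execute `c` if the register `r` is set. -/
noncomputable def onlyIf (r : Flag) (c : TimedProg) : TimedProg :=
  ⟨.ite (fun v => v.2 r) c.prog clearTop, c.bound + 2⟩

/-- Push the bit `b` onto the data stack `k`. -/
noncomputable def pushDat (k : Dat) (b : Bool) : TimedProg :=
  ⟨.push (.dat k) fun _ => b, 1⟩

/-- Read the bit of the data stack `A` at the given index into the register `r`. -/
noncomputable def read (A : Dat) (l : List (Var × Dat)) (r : Flag) : TimedProg :=
  ⟨readAt A l r, C l.length * (X * (X * 10 + 10) + 4) + 3 * X + 5⟩

/-- Overwrite the bit of the data stack `A` at the given index by `true`. -/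
noncomputable def set (A : Dat) (l : List (Var × Dat)) : TimedProg :=
  ⟨setAt A l, C l.length * (X * (X * 10 + 10) + 4) + 3 * X + 5⟩

end TimedProg

open TimedProg

namespace Triple

variable {N : ℕ} {d e : Var → ℕ} {P P' Q Q' R : Mem → Prop} {c c₁ c₂ : TimedProg}

theorem weaken (h : Triple N d e P c Q) (hP : ∀ μ, P' μ → P μ) (hQ : ∀ μ, Q μ → Q' μ) :
    Triple N d e P' c Q' := fun μ hμ => by
  obtain ⟨μ', h₁, h₂⟩ := h μ (hP μ hμ)
  exact ⟨μ', hQ μ' h₁, h₂⟩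

theorem seq (h₁ : Triple N d e P c₁ Q) (h₂ : Triple N d e Q c₂ R) :
    Triple N d e P (c₁.seq c₂) R := fun μ hμ => by
  obtain ⟨μ₁, hμ₁, h₁⟩ := h₁ μ hμ
  obtain ⟨μ₂, hμ₂, h₂⟩ := h₂ μ₁ hμ₁
  refine ⟨μ₂, hμ₂, (h₁.seq h₂).mono ?_⟩
  simp [TimedProg.seq]

theorem assign (r : Flag) (f : (Flag → Bool) → Bool) :
    Triple N d e (fun μ => Q ⟨update μ.flag r (f μ.flag), μ.dat⟩) (assign r f) Q :=
  fun μ hμ => ⟨_, hμ, (Runs.load _ _ _).of_eq rfl (by simp [TimedProg.assign])⟩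

theorem pushDat (k : Dat) (b : Bool) :
    Triple N d e (fun μ => Q ⟨μ.flag, update μ.dat k (b :: μ.dat k)⟩) (pushDat k b) Q :=
  fun μ hμ => ⟨_, hμ, (Runs.push _ _ _ _).of_eq
    (Prod.ext rfl (update_stk_dat d e μ.dat k _)) (by simp [TimedProg.pushDat])⟩

theorem onlyIf {r : Flag} (h : Triple N d e (fun μ => P μ ∧ μ.flag r = true) c Q)
    (h' : ∀ μ, P μ → μ.flag r = false → Q μ) : Triple N d e P (onlyIf r c) Q := fun μ hμ => by
  by_cases hr : μ.flag r = true
  · obtain ⟨μ', hμ', h⟩ := h μ ⟨hμ, hr⟩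
    exact ⟨μ', hμ', (Runs.ite_true hr h).mono (by simp [TimedProg.onlyIf])⟩
  · rw [Bool.not_eq_true] at hr
    exact ⟨μ, h' μ hμ hr, (Runs.ite_false hr (runs_clearTop _ _ _)).mono
      (by simp [TimedProg.onlyIf])⟩

/-- `I v` is the invariant before the round with `x = v`. A round transfers one bit from `.hi x` to
`.lo x`, and a look at `.hi x` tells whether another round is due. A round costs 5 steps besides its
body, and the final pour that resets `x` costs 3 per bit; this gives the 8 in the time bound. -/
theorem forVar {x : Var} {I : ℕ → Mem → Prop} (he : e x = 0) (hN : d x ≤ N)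
    (h : ∀ v < d x, Triple N d (update e x v) (I v) c (I (v + 1))) :
    Triple N d e (I 0) (forVar x c) (I (d x)) := by
  have hloop : ∀ j v, v + j = d x → ∀ μ, I v μ → ∃ μ', I (d x) μ' ∧
      Runs (.loop hasTop (.seq clearTop (.seq c.prog (.seq (popTop (.hi x))
        (.seq (.push (.lo x) fun _ => true) (peekTop (.hi x)))))))
        (((List.replicate j true).head?, μ.flag), stk d (update e x v) μ.dat)
        (j * (c.bound.eval N + 5) + 1)
        ((none, μ'.flag), stk d (update e x (d x)) μ'.dat) := by
    intro j
    induction j with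
    | zero =>
      intro v hv μ hμ
      obtain rfl : v = d x := by omega
      exact ⟨μ, hμ, (runs_while_false _ _ _).mono (by omega)⟩
    | succ j ih =>
      intro v hv μ hμ
      obtain ⟨μ₁, hμ₁, h₁⟩ := h v (by omega) μ hμ
      obtain ⟨μ₂, hμ₂, h₂⟩ := ih (v + 1) (by omega) μ₁ hμ₁
      refine ⟨μ₂, hμ₂, ?_⟩
      have hpush := Runs.push (.lo x) (fun _ : Reg => true)
        ((stk d (update e x v) μ₁.dat (.hi x)).head?, μ₁.flag)
        (update (stk d (update e x v) μ₁.dat) (.hi x)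
          (stk d (update e x v) μ₁.dat (.hi x)).tail)
      have hbody := (runs_popTop (.hi x) none μ₁.flag (stk d (update e x v) μ₁.dat)).seq
        (hpush.seq (runs_peekTop (.hi x) _ _ _))
      have hst : update (update (stk d (update e x v) μ₁.dat) (.hi x)
          (stk d (update e x v) μ₁.dat (.hi x)).tail) (.lo x)
          (true :: update (stk d (update e x v) μ₁.dat) (.hi x)
            (stk d (update e x v) μ₁.dat (.hi x)).tail (.lo x)) =
          stk d (update e x (v + 1)) μ₁.dat := by
        funext k
        cases k with
        | lo y =>
          by_cases hy : y = x
          · subst hy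
            simp [stk, List.replicate_succ]
          · simp [stk, hy]
        | hi y =>
          by_cases hy : y = x
          · subst hy
            simp [stk, Nat.sub_sub]
          · simp [stk, hy]
        | dat k => simp [stk]
      rw [hst] at hbody
      have hhi : stk d (update e x (v + 1)) μ₁.dat (.hi x) = List.replicate j true := by
        simp only [stk, update_self]
        congr 1
        omega
      rw [hhi] at hbody
      refine (runs_while_true ((runs_clearTop _ _ _).seq (h₁.seq hbody)) h₂).mono ?_
      ring_nf
      omega
  intro μ hμ
  obtain ⟨μ', hμ', h⟩ := hloop (d x) 0 (by omega) μ hμ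
  refine ⟨μ', hμ', ?_⟩
  have hpeek := runs_peekTop (.hi x) none μ.flag (stk d e μ.dat)
  have hx : update e x 0 = e := by rw [← he, update_eq_self]
  have hhi : stk d e μ.dat (.hi x) = List.replicate (d x) true := by simp [stk, he]
  rw [hhi] at hpeek
  rw [hx] at h
  refine (hpeek.seq (h.seq (runs_pour (by simp) none _ _))).of_eq ?_ ?_
  · refine Prod.ext rfl (funext fun k => ?_)
    cases k with
    | lo y =>
      by_cases hy : y = x
      · subst hy
        simp [conf, stk, he]
      · simp [conf, stk, hy]
    | hi y =>
      by_cases hy : y = x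
      · subst hy
        simp [conf, stk, he]
      · simp [conf, stk, hy]
    | dat k => simp [conf, stk]
  · have := Nat.mul_le_mul_right (c.bound.eval N + 8) hN
    simp only [stk, update_self, List.length_replicate, TimedProg.forVar, eval_add, eval_mul,
      eval_X, eval_ofNat]
    refine le_trans ?_ (Nat.add_le_add_right this 4)
    ring_nf
    omega

/-- A loop whose body advances a counter by `a` advances it by the `d x`-fold of `a`. -/
theorem forVar_count {x : Var} {μ : ℕ → Mem} {a : ℕ} (he : e x = 0) (hN : d x ≤ N)
    (h : ∀ v j, Triple N d (update e x v) (· = μ j) c (· = μ (j + a))) (j : ℕ) :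
    Triple N d e (· = μ j) (TimedProg.forVar x c) (· = μ (j + d x * a)) := by
  have := forVar (c := c) (I := fun v ν => ν = μ (j + v * a)) he hN fun v _ => by
    rw [Nat.succ_mul, ← Nat.add_assoc]
    exact h v _
  simpa using this

end Triple

/-! ### The tables of a machine -/

section Tables

variable (n m k : ℕ) (T H : List Bool)

/-- The entry of the transition table at `(s, i, o, s')`. -/
def transBit (s i o s' : ℕ) : Bool :=
  T.getD (s * (m * (k * n)) + i * (k * n) + o * n + s') false

/-- The entry of the table of pairs of states at `(s, t)`. -/
def pairBit (s t : ℕ) : Bool := H.getD (s * n + t) false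

/-- The bounds of the loop variables. -/
def dims : Var → ℕ
  | .i => m
  | .o => k
  | _ => n

/-- The data stacks when the transition table is `T` and the table of pairs is `H`. -/
def store : Dat → List Bool
  | .inp => T
  | .tab => H
  | .one => [true]
  | .strideO => List.replicate n true
  | .strideI => List.replicate (k * n) true
  | .strideS => List.replicate (m * (k * n)) true
  | _ => []

/-- `N` bounds the heights of all stacks. -/
structure IsBound (N : ℕ) : Prop where
  one : 1 ≤ N
  dims : ∀ x, dims n m k x ≤ N
  strideI : k * n ≤ N
  strideS : m * (k * n) ≤ N
  table : T.length ≤ N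
  pairs : n * n ≤ N

/-- The property of memories that the registers and the table of pairs satisfy `P`. -/
def At (P : (Flag → Bool) → List Bool → Prop) (μ : Mem) : Prop :=
  ∃ H : List Bool, H.length = n * n ∧ μ.dat = store n m k T H ∧ P μ.flag H

end Tables

/-- Read the transition table at `(x, i, o, y)` into the register `r`. -/
noncomputable def readTrans (x y : Var) (r : Flag) : TimedProg :=
  .read .inp [(x, .strideS), (.i, .strideI), (.o, .strideO), (y, .one)] r

/-- Read the table of pairs at `(x, y)` into the register `r`. -/
noncomputable def readPair (x y : Var) (r : Flag) : TimedProg :=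
  .read .tab [(x, .strideO), (y, .one)] r

/-- Mark the pair `(x, y)` in the table of pairs. -/
noncomputable def setPair (x y : Var) : TimedProg :=
  .set .tab [(x, .strideO), (y, .one)]

namespace Triple

variable {n m k N : ℕ} {T : List Bool} {e : Var → ℕ} {P P' Q : (Flag → Bool) → List Bool → Prop}
  {c : TimedProg}

/-- The lengths of the strides. -/
def strideLength (n m k : ℕ) : Dat → ℕ
  | .one => 1
  | .strideO => n
  | .strideI => k * n
  | .strideS => m * (k * n)
  | _ => 0

/-- The rule has the form of a weakest precondition, with `Q` arbitrary, so that sequences of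
commands are verified backwards. The four strides turn a quadruple into its lexicographic position.
-/
theorem readTrans (hN : IsBound n m k T N) (he : ∀ x, e x ≤ dims n m k x) (x y : Var) (r : Flag) :
    Triple N (dims n m k) e
      (At n m k T fun fl H =>
        Q (update fl r (transBit n m k T (e x) (e .i) (e .o) (e y))) H)
      (readTrans x y r) (At n m k T Q) := by
  rintro ⟨fl, D⟩ ⟨H, hH, hD, hQ⟩
  obtain rfl : D = store n m k T H := hD
  refine ⟨⟨update fl r (transBit n m k T (e x) (e .i) (e .o) (e y)), store n m k T H⟩,
    ⟨H, hH, rfl, hQ⟩, ?_⟩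
  have he' (x) : e x ≤ N := (he x).trans (hN.dims x)
  have h := runs_readAt (A := .inp) (N := N) (e := e) (c := strideLength n m k)
    (l := [(x, .strideS), (.i, .strideI), (.o, .strideO), (y, .one)])
    (S := stk (dims n m k) e (store n m k T H)) (by simp [Accessible, stk, store]) rfl (by
      simp [IsStride, stk, store, strideLength, he', hN.one, hN.strideI, hN.strideS,
        show n ≤ N from hN.dims .s]) hN.table r fl
  refine h.of_eq ?_ ?_
  · simp [conf, stk, store, strideLength, transBit, add_assoc]
  · simp [HomingMachine.readTrans, TimedProg.read]

theorem readPair (hN : IsBound n m k T N) (he : ∀ x, e x ≤ dims n m k x) (x y : Var) (r : Flag) :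
    Triple N (dims n m k) e
      (At n m k T fun fl H => Q (update fl r (pairBit n H (e x) (e y))) H)
      (readPair x y r) (At n m k T Q) := by
  rintro ⟨fl, D⟩ ⟨H, hH, hD, hQ⟩
  obtain rfl : D = store n m k T H := hD
  refine ⟨⟨update fl r (pairBit n H (e x) (e y)), store n m k T H⟩, ⟨H, hH, rfl, hQ⟩, ?_⟩
  have he' (x) : e x ≤ N := (he x).trans (hN.dims x)
  have h := runs_readAt (A := .tab) (N := N) (e := e) (c := strideLength n m k)
    (l := [(x, .strideO), (y, .one)])
    (S := stk (dims n m k) e (store n m k T H)) (by simp [Accessible, stk, store]) rfl (by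
      simp [IsStride, stk, store, strideLength, he', hN.one,
        show n ≤ N from hN.dims .s]) (hH.trans_le hN.pairs) r fl
  refine h.of_eq ?_ ?_
  · simp [conf, stk, store, strideLength, pairBit]
  · simp [HomingMachine.readPair, TimedProg.read]

/-- In contrast to reading, writing needs strict bounds, which place the index below `n * n`. -/
theorem setPair (hN : IsBound n m k T N) (he : ∀ x, e x ≤ dims n m k x) (x y : Var)
    (hx : e x < n) (hy : e y < n) :
    Triple N (dims n m k) e
      (At n m k T fun fl H => Q fl (H.set (e x * n + e y) true))
      (setPair x y) (At n m k T Q) := by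
  rintro ⟨fl, D⟩ ⟨H, hH, hD, hQ⟩
  obtain rfl : D = store n m k T H := hD
  refine ⟨⟨fl, store n m k T (H.set (e x * n + e y) true)⟩,
    ⟨_, by rw [List.length_set, hH], rfl, hQ⟩, ?_⟩
  have he' (x) : e x ≤ N := (he x).trans (hN.dims x)
  have hlt : e x * n + e y < n * n := by nlinarith
  have h := runs_setAt (A := .tab) (N := N) (e := e) (c := strideLength n m k)
    (l := [(x, .strideO), (y, .one)])
    (S := stk (dims n m k) e (store n m k T H)) (by simp [Accessible, stk, store]) rfl (by
      simp [IsStride, stk, store, strideLength, he', hN.one,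
        show n ≤ N from hN.dims .s]) (hH.trans_le hN.pairs)
      (by simpa [stk, store, strideLength, hH] using hlt) fl
  have hst : update (store n m k T H) .tab (H.set (e x * n + e y) true) =
      store n m k T (H.set (e x * n + e y) true) := by
    ext1 j
    cases j <;> simp [store]
  refine h.of_eq ?_ ?_
  · rw [update_stk_dat]
    simp only [conf, ← hst]
    simp [stk, store, strideLength]
  · simp [HomingMachine.setPair, TimedProg.set]

theorem assignAt (r : Flag) (f : (Flag → Bool) → Bool) :
    Triple N (dims n m k) e (At n m k T fun fl H => Q (update fl r (f fl)) H) (.assign r f)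
      (At n m k T Q) :=
  (Triple.assign r f).weaken (fun _ h => h) fun _ h => h

theorem onlyIfAt {r : Flag}
    (h : Triple N (dims n m k) e (At n m k T fun fl H => P fl H ∧ fl r = true) c (At n m k T Q))
    (h' : ∀ fl H, P fl H → fl r = false → Q fl H) :
    Triple N (dims n m k) e (At n m k T P) (.onlyIf r c) (At n m k T Q) := by
  refine Triple.onlyIf (h.weaken ?_ fun _ h => h) ?_
  · rintro μ ⟨⟨H, hH, hD, hP⟩, hr⟩
    exact ⟨H, hH, hD, hP, hr⟩
  · rintro μ ⟨H, hH, hD, hP⟩ hr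
    exact ⟨H, hH, hD, h' _ _ hP hr⟩

theorem weakenAt (h : Triple N (dims n m k) e (At n m k T P) c (At n m k T Q))
    (hP : ∀ fl H, H.length = n * n → P' fl H → P fl H) :
    Triple N (dims n m k) e (At n m k T P') c (At n m k T Q) := by
  refine h.weaken ?_ fun _ h => h
  rintro μ ⟨H, hH, hD, hP'⟩
  exact ⟨H, hH, hD, hP _ _ hH hP'⟩

/-- The rule for loops that run from a precondition to a postcondition. -/
theorem forVarAt {x : Var} {I : ℕ → (Flag → Bool) → List Bool → Prop} (hN : IsBound n m k T N)
    (he : e x = 0)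
    (h : ∀ v < dims n m k x, Triple N (dims n m k) (update e x v) (At n m k T (I v)) c
      (At n m k T (I (v + 1))))
    (hP : ∀ fl H, P fl H → I 0 fl H) (hQ : ∀ fl H, I (dims n m k x) fl H → Q fl H) :
    Triple N (dims n m k) e (At n m k T P) (.forVar x c) (At n m k T Q) := by
  refine (Triple.forVar (I := fun v => At n m k T (I v)) he (hN.dims x) h).weaken ?_ ?_
  · rintro μ ⟨H, hH, hD, hP'⟩
    exact ⟨H, hH, hD, hP _ _ hP'⟩
  · rintro μ ⟨H, hH, hD, hP'⟩
    exact ⟨H, hH, hD, hQ _ _ hP'⟩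

end Triple

/-! ### Evaluating bounded quantifiers in a register -/

section

variable (n m k N : ℕ) (T : List Bool)

/-- The program `c` replaces the register `r` by its conjunction with `ψ`, preserving `F`. -/
def AndsTo (e : Var → ℕ) (F : (Flag → Bool) → List Bool → Prop) (c : TimedProg) (r : Flag)
    (ψ : Prop) : Prop :=
  ∀ φ : Prop, Triple N (dims n m k) e
    (At n m k T fun fl H => (fl r = true ↔ φ) ∧ F fl H) c
    (At n m k T fun fl H => (fl r = true ↔ φ ∧ ψ) ∧ F fl H)

/-- The program `c` replaces the register `r` by its disjunction with `ψ`, preserving `F`. -/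
def OrsTo (e : Var → ℕ) (F : (Flag → Bool) → List Bool → Prop) (c : TimedProg) (r : Flag)
    (ψ : Prop) : Prop :=
  ∀ φ : Prop, Triple N (dims n m k) e
    (At n m k T fun fl H => (fl r = true ↔ φ) ∧ F fl H) c
    (At n m k T fun fl H => (fl r = true ↔ φ ∨ ψ) ∧ F fl H)

end

/-- The property `F` does not depend on the register `r`. -/
def Indep (F : (Flag → Bool) → List Bool → Prop) (r : Flag) : Prop :=
  ∀ fl H b, F fl H → F (update fl r b) H

variable {n m k N : ℕ} {T : List Bool} {e : Var → ℕ} {F : (Flag → Bool) → List Bool → Prop}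
  {c : TimedProg} {r : Flag} {ψ ψ' : Prop}

theorem AndsTo.congr (h : AndsTo n m k N T e F c r ψ) (hψ : ψ ↔ ψ') :
    AndsTo n m k N T e F c r ψ' := propext hψ ▸ h

theorem OrsTo.congr (h : OrsTo n m k N T e F c r ψ) (hψ : ψ ↔ ψ') :
    OrsTo n m k N T e F c r ψ' := propext hψ ▸ h

/-- Since `AndsTo` allows any previous meaning `φ` of the register, each round can start from the
conjunction accumulated so far. Thus a bounded universal quantifier becomes a loop. -/
theorem AndsTo.forVar {x : Var} {ψ : ℕ → Prop} (hN : IsBound n m k T N) (he : e x = 0)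
    (h : ∀ v < dims n m k x, AndsTo n m k N T (update e x v) F c r (ψ v)) :
    AndsTo n m k N T e F (forVar x c) r (∀ v < dims n m k x, ψ v) := fun φ => by
  refine Triple.forVarAt (I := fun v fl H => (fl r = true ↔ φ ∧ ∀ w < v, ψ w) ∧ F fl H) hN he
    (fun v hv => ?_) ?_ ?_
  · simp only [Nat.forall_lt_succ_right, ← and_assoc (a := φ)]
    exact h v hv _
  · simp
  · exact fun _ _ h => h

theorem OrsTo.forVar {x : Var} {ψ : ℕ → Prop} (hN : IsBound n m k T N) (he : e x = 0)
    (h : ∀ v < dims n m k x, OrsTo n m k N T (update e x v) F c r (ψ v)) :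
    OrsTo n m k N T e F (forVar x c) r (∃ v < dims n m k x, ψ v) := fun φ => by
  refine Triple.forVarAt (I := fun v fl H => (fl r = true ↔ φ ∨ ∃ w < v, ψ w) ∧ F fl H) hN he
    (fun v hv => ?_) ?_ ?_
  · simp only [Nat.exists_lt_succ_right, ← or_assoc (a := φ)]
    exact h v hv _
  · simp
  · exact fun _ _ h => h

/-- Compute the register `r'`, initialized by a constant, by `c` and combine it with the register
`r`. -/
theorem AndsTo.of_orsTo {r' : Flag} (hr : r ≠ r') (hF : Indep F r) (hF' : Indep F r')
    (h : ∀ φ : Prop, OrsTo n m k N T e (fun fl H => (fl r = true ↔ φ) ∧ F fl H) c r' ψ) :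
    AndsTo n m k N T e F
      ((assign r' fun _ => false).seq (c.seq (assign r fun fl => fl r && fl r'))) r ψ :=
  fun φ => by
  refine Triple.seq ((Triple.assignAt r' _).weakenAt ?_)
    (Triple.seq (h φ False) ((Triple.assignAt r _).weakenAt ?_))
  · rintro fl H _ ⟨h₁, h₂⟩
    exact ⟨by simp, by simpa [hr] using h₁, hF' _ _ _ h₂⟩
  · rintro fl H _ ⟨h₁, h₂, h₃⟩
    refine ⟨?_, hF _ _ _ h₃⟩
    simp [h₁, h₂]

/-- Compute the register `r'`, initialized by a constant, by `c` and combine it with the register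
`r`. -/
theorem OrsTo.of_andsTo {r' : Flag} (hr : r ≠ r') (hF : Indep F r) (hF' : Indep F r')
    (h : ∀ φ : Prop, AndsTo n m k N T e (fun fl H => (fl r = true ↔ φ) ∧ F fl H) c r' ψ) :
    OrsTo n m k N T e F
      ((assign r' fun _ => true).seq (c.seq (assign r fun fl => fl r || fl r'))) r ψ :=
  fun φ => by
  refine Triple.seq ((Triple.assignAt r' _).weakenAt ?_)
    (Triple.seq (h φ True) ((Triple.assignAt r _).weakenAt ?_))
  · rintro fl H _ ⟨h₁, h₂⟩
    exact ⟨by simp, by simpa [hr] using h₁, hF' _ _ _ h₂⟩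
  · rintro fl H _ ⟨h₁, h₂, h₃⟩
    refine ⟨?_, hF _ _ _ h₃⟩
    simp [h₁, h₂]

/-! ### The checks -/

/-- Is there a transition at `(s, i, o, u)`? -/
noncomputable def someTrans : TimedProg :=
  (readTrans .s .u .r₂).seq (assign .r₁ fun fl => fl .r₁ || fl .r₂)

/-- Check that transitions at `(x, i, o, u)` and `(y, i, o, v)` imply that the pair `(u, v)` is
marked. -/
noncomputable def checkPair (x y : Var) (r : Flag) : TimedProg :=
  (readTrans x .u .r₁).seq ((readTrans y .v .r₂).seq ((readPair .u .v .r₃).seq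
    (assign r fun fl => fl r && (!(fl .r₁ && fl .r₂) || fl .r₃))))

/-- Check that the machine is complete. -/
noncomputable def checkComplete : TimedProg :=
  forVar .s (forVar .i ((assign .r₁ fun _ => false).seq ((forVar .o (forVar .u someTrans)).seq
    (assign .ok fun fl => fl .ok && fl .r₁))))

/-- Check that the machine is observable, if exactly the pairs on the diagonal are marked. -/
noncomputable def checkObservable : TimedProg :=
  forVar .s (forVar .i (forVar .o (forVar .u (forVar .v (checkPair .s .s .ok)))))

/-- Mark the pairs on the diagonal. -/
noncomputable def markDiagonal : TimedProg :=
  forVar .s (setPair .s .s)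

/-- Is there an input for which all outputs lead from the pair `(s, t)` to marked pairs only? -/
noncomputable def someInput : TimedProg :=
  forVar .i ((assign .all fun _ => true).seq
    ((forVar .o (forVar .u (forVar .v (checkPair .s .t .all)))).seq
      (assign .ex fun fl => fl .ex || fl .all)))

/-- Mark the pairs for which some input leads to marked pairs only. -/
noncomputable def round : TimedProg :=
  forVar .s (forVar .t ((assign .ex fun _ => false).seq
    (someInput.seq (onlyIf .ex (setPair .s .t)))))

/-- Check that all pairs are marked. -/
noncomputable def checkPairs : TimedProg :=
  forVar .s (forVar .t ((readPair .s .t .r₁).seq (assign .ok fun fl => fl .ok && fl .r₁)))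

theorem update_le_dims (he : ∀ y, e y ≤ dims n m k y) {x : Var} {v : ℕ} (hv : v < dims n m k x) :
    ∀ y, update e x v y ≤ dims n m k y := by
  intro y
  by_cases hy : y = x
  · subst hy
    simpa using hv.le
  · simpa [hy] using he y

theorem orsTo_someTrans (hN : IsBound n m k T N) (he : ∀ x, e x ≤ dims n m k x)
    (hF₁ : Indep F .r₁) (hF₂ : Indep F .r₂) :
    OrsTo n m k N T e F someTrans .r₁
      (transBit n m k T (e .s) (e .i) (e .o) (e .u) = true) := fun φ => by
  refine Triple.weakenAt (Triple.seq (Triple.readTrans hN he _ _ _) (Triple.assignAt _ _)) ?_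
  rintro fl H _ ⟨h₁, h₂⟩
  refine ⟨?_, hF₁ _ _ _ (hF₂ _ _ _ h₂)⟩
  simp [h₁]

/-- The table is pinned to a fixed `H`, so that the formula can refer to its marks. `F` carries what
is known about other registers and must survive changes of the four registers used. -/
theorem andsTo_checkPair (hN : IsBound n m k T N) (he : ∀ x, e x ≤ dims n m k x)
    {F : (Flag → Bool) → Prop} (x y : Var) {r : Flag} (hr : r ≠ .r₁ ∧ r ≠ .r₂ ∧ r ≠ .r₃)
    {H : List Bool} (hF : ∀ r' fl b, r' = r ∨ r' = .r₁ ∨ r' = .r₂ ∨ r' = .r₃ → F fl →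
      F (update fl r' b)) :
    AndsTo n m k N T e (fun fl H' => F fl ∧ H' = H) (checkPair x y r) r
      (transBit n m k T (e x) (e .i) (e .o) (e .u) = true →
        transBit n m k T (e y) (e .i) (e .o) (e .v) = true →
          pairBit n H (e .u) (e .v) = true) := fun φ => by
  refine Triple.weakenAt (Triple.seq (Triple.readTrans hN he _ _ _)
    (Triple.seq (Triple.readTrans hN he _ _ _) (Triple.seq (Triple.readPair hN he _ _ _)
      (Triple.assignAt _ _)))) ?_
  rintro fl H _ ⟨h₁, h₂, rfl⟩
  refine ⟨?_, hF _ _ _ (by simp) (hF _ _ _ (by simp) (hF _ _ _ (by simp)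
    (hF _ _ _ (by simp) h₂))), rfl⟩
  simp only [update_self, update_of_ne hr.1, update_of_ne hr.2.1, update_of_ne hr.2.2,
    Bool.and_eq_true, h₁, Bool.or_eq_true, Bool.not_eq_true', Bool.and_eq_false_iff]
  simp [imp_iff_not_or, or_assoc]

theorem zero_le_dims (n m k : ℕ) (x : Var) : (0 : Var → ℕ) x ≤ dims n m k x := Nat.zero_le _

theorem andsTo_checkComplete (hN : IsBound n m k T N) (R : List Bool → Prop) :
    AndsTo n m k N T 0 (fun _ H => R H) checkComplete .ok
      (∀ s < n, ∀ i < m, ∃ o < k, ∃ u < n, transBit n m k T s i o u = true) := by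
  refine AndsTo.forVar hN rfl fun s hs => AndsTo.forVar hN rfl fun i hi =>
    AndsTo.of_orsTo (by decide) (fun _ _ _ h => h) (fun _ _ _ h => h) fun φ =>
    OrsTo.forVar hN rfl fun o ho => OrsTo.forVar hN rfl fun u hu =>
      (orsTo_someTrans hN ?_ ?_ ?_).congr ?_
  · exact update_le_dims (update_le_dims (update_le_dims (update_le_dims (zero_le_dims n m k)
      hs) hi) ho) hu
  · exact fun fl H b h => by simpa using h
  · exact fun fl H b h => by simpa using h
  · simp

theorem andsTo_checkObservable (hN : IsBound n m k T N) (H : List Bool) :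
    AndsTo n m k N T 0 (fun _ H' => True ∧ H' = H) checkObservable .ok
      (∀ s < n, ∀ i < m, ∀ o < k, ∀ u < n, ∀ v < n, transBit n m k T s i o u = true →
        transBit n m k T s i o v = true → pairBit n H u v = true) := by
  refine AndsTo.forVar hN rfl fun s hs => AndsTo.forVar hN rfl fun i hi =>
    AndsTo.forVar hN rfl fun o ho => AndsTo.forVar hN rfl fun u hu =>
    AndsTo.forVar hN rfl fun v hv =>
      (andsTo_checkPair hN ?_ _ _ (by decide) (fun _ _ _ _ h => h)).congr ?_
  · exact update_le_dims (update_le_dims (update_le_dims (update_le_dims (update_le_dims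
      (zero_le_dims n m k) hs) hi) ho) hu) hv
  · simp

theorem andsTo_checkPairs (hN : IsBound n m k T N) (H : List Bool) :
    AndsTo n m k N T 0 (fun _ H' => H' = H) checkPairs .ok
      (∀ s < n, ∀ t < n, pairBit n H s t = true) := by
  refine AndsTo.forVar hN rfl fun s hs => AndsTo.forVar hN rfl fun t ht => fun φ => ?_
  refine Triple.weakenAt (Triple.seq (Triple.readPair hN
    (update_le_dims (update_le_dims (zero_le_dims n m k) hs) ht) _ _ _) (Triple.assignAt _ _)) ?_
  rintro fl H _ ⟨h₁, rfl⟩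
  simp [h₁]

/-- Some input leads from the pair `(s, t)` to pairs in `R` only. -/
def Step (n m k : ℕ) (T : List Bool) (R : ℕ → ℕ → Prop) (s t : ℕ) : Prop :=
  ∃ i < m, ∀ o < k, ∀ u < n, ∀ v < n, transBit n m k T s i o u = true →
    transBit n m k T t i o v = true → R u v

theorem Step.mono {R R' : ℕ → ℕ → Prop} {s t : ℕ} (h : Step n m k T R s t)
    (hR : ∀ u < n, ∀ v < n, R u v → R' u v) : Step n m k T R' s t := by
  obtain ⟨i, hi, h⟩ := h
  exact ⟨i, hi, fun o ho u hu v hv h₁ h₂ => hR u hu v hv (h o ho u hu v hv h₁ h₂)⟩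

theorem orsTo_someInput (hN : IsBound n m k T N) (he : ∀ x, e x ≤ dims n m k x)
    (hi₀ : e .i = 0) (ho₀ : e .o = 0) (hu₀ : e .u = 0) (hv₀ : e .v = 0) {F : (Flag → Bool) → Prop}
    (H : List Bool)
    (hF : ∀ r fl b, r ≠ .ok → F fl → F (update fl r b)) :
    OrsTo n m k N T e (fun fl H' => F fl ∧ H' = H) someInput .ex
      (Step n m k T (fun u v => pairBit n H u v = true) (e .s) (e .t)) := by
  refine OrsTo.forVar hN hi₀ fun i hi => OrsTo.of_andsTo (by decide)
    (fun fl H b h => ⟨hF _ _ _ (by decide) h.1, h.2⟩)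
    (fun fl H b h => ⟨hF _ _ _ (by decide) h.1, h.2⟩) fun φ =>
    AndsTo.forVar hN (by simpa) fun o ho => AndsTo.forVar hN (by simpa) fun u hu =>
    AndsTo.forVar hN (by simpa) fun v hv => ?_
  have := (andsTo_checkPair (F := fun fl => (fl .ex = true ↔ φ) ∧ F fl) (H := H) hN
    (update_le_dims (update_le_dims (update_le_dims (update_le_dims he hi) ho) hu) hv) .s .t
    (r := .all) (by decide) ?_)
  · simpa [and_assoc] using this
  · rintro r' fl b (rfl | rfl | rfl | rfl) ⟨h, h'⟩ <;>
      exact ⟨by simpa using h, hF _ _ _ (by decide) h'⟩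

/-- Division with remainder by `n` recovers both coordinates from a position, as `t` and `v` are
below `n`. -/
theorem pairBit_set {H : List Bool} (hH : H.length = n * n) {s t u v : ℕ} (hs : s < n)
    (ht : t < n) (hv : v < n) :
    pairBit n (H.set (s * n + t) true) u v = true ↔ (u = s ∧ v = t) ∨ pairBit n H u v = true := by
  have hlt : s * n + t < H.length := by
    rw [hH]
    nlinarith
  have hiff : s * n + t = u * n + v ↔ u = s ∧ v = t := by
    constructor
    · intro h
      have h₁ := congrArg (· / n) h
      have h₂ := congrArg (· % n) h
      have hn : 0 < n := by omega
      simp only [Nat.mul_add_mod', Nat.mod_eq_of_lt ht, Nat.mod_eq_of_lt hv] at h₂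
      rw [mul_comm s, mul_comm u] at h₁
      simp only [Nat.mul_add_div hn, Nat.div_eq_of_lt ht, Nat.div_eq_of_lt hv] at h₁
      exact ⟨by omega, h₂.symm⟩
    · rintro ⟨rfl, rfl⟩
      rfl
  unfold pairBit
  rw [List.getD_eq_getElem?_getD, List.getD_eq_getElem?_getD, List.getElem?_set]
  simp only [hiff]
  split_ifs with h₁
  · simp [h₁]
  · simp [h₁]

theorem triple_markDiagonal (hN : IsBound n m k T N) (G : (Flag → Bool) → Prop) :
    Triple N (dims n m k) 0
      (At n m k T fun fl H => G fl ∧ ∀ u < n, ∀ v < n, pairBit n H u v = false) markDiagonal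
      (At n m k T fun fl H => G fl ∧ ∀ u < n, ∀ v < n, (pairBit n H u v = true ↔ u = v)) := by
  refine Triple.forVarAt (I := fun w fl H => G fl ∧ ∀ u < n, ∀ v < n,
    (pairBit n H u v = true ↔ u = v ∧ u < w)) hN rfl (fun w hw => ?_) ?_ ?_
  · refine (Triple.setPair hN (update_le_dims (zero_le_dims n m k) hw) .s .s
      (by simpa [dims] using hw) (by simpa [dims] using hw)).weakenAt ?_
    rintro fl H hH ⟨h₁, h₂⟩
    refine ⟨h₁, fun u hu v hv => ?_⟩
    simp only [update_self]
    rw [pairBit_set hH hw hw hv, h₂ u hu v hv]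
    omega
  · rintro fl H ⟨h₁, h₂⟩
    exact ⟨h₁, fun u hu v hv => by simp [h₂ u hu v hv]⟩
  · rintro fl H ⟨h₁, h₂⟩
    refine ⟨h₁, fun u hu v hv => ?_⟩
    rw [h₂ u hu v hv]
    exact and_iff_left hu

/-- The marked pairs comprise `L` and are contained in `R`. -/
def Between (n : ℕ) (L R : ℕ → ℕ → Prop) (H : List Bool) : Prop :=
  ∀ u < n, ∀ v < n, (L u v → pairBit n H u v = true) ∧ (pairBit n H u v = true → R u v)

/-- The table is updated in place, so marks set early in a round influence later ones, and the exact
result depends on the order of the loops. Only a sandwich is tracked: as `Step` is monotone, the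
round covers a simultaneous round starting from `L`, and a relation `R` closed under `Step` is never
left. -/
theorem triple_round (hN : IsBound n m k T N) (he : ∀ x, e x ≤ dims n m k x)
    (hs₀ : e .s = 0) (ht₀ : e .t = 0) (hi₀ : e .i = 0) (ho₀ : e .o = 0) (hu₀ : e .u = 0)
    (hv₀ : e .v = 0) {L R : ℕ → ℕ → Prop} (φ : Prop)
    (hR : ∀ s < n, ∀ t < n, Step n m k T R s t → R s t) :
    Triple N (dims n m k) e
      (At n m k T fun fl H => (fl .ok = true ↔ φ) ∧ Between n L R H) round
      (At n m k T fun fl H => (fl .ok = true ↔ φ) ∧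
        Between n (fun s t => L s t ∨ Step n m k T L s t) R H) := by
  refine Triple.forVarAt (I := fun w fl H => (fl .ok = true ↔ φ) ∧ Between n L R H ∧
    ∀ s < w, ∀ t < n, Step n m k T L s t → pairBit n H s t = true) hN hs₀ (fun s hs => ?_)
    (fun fl H h => ⟨h.1, h.2, by simp⟩) ?_
  · refine Triple.forVarAt (I := fun w fl H => (fl .ok = true ↔ φ) ∧ Between n L R H ∧
      (∀ s' < s, ∀ t < n, Step n m k T L s' t → pairBit n H s' t = true) ∧
      ∀ t < w, Step n m k T L s t → pairBit n H s t = true) hN (by simpa) (fun t ht => ?_)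
      (fun fl H h => ⟨h.1, h.2.1, h.2.2, by simp⟩) ?_
    · rintro μ ⟨H, hH, hD, hok, hLR, hs', ht'⟩
      have he' := update_le_dims (update_le_dims he hs) ht
      have hex := orsTo_someInput (T := T) hN he' (by simpa) (by simpa) (by simpa) (by simpa)
        (F := fun fl => fl .ok = true ↔ φ) H (fun r fl b hr h => by simpa [hr.symm] using h) False
      have hset := Triple.setPair (Q := fun fl H' => (fl .ok = true ↔ φ) ∧ Between n L R H' ∧
        (∀ s' < s, ∀ t < n, Step n m k T L s' t → pairBit n H' s' t = true) ∧
        ∀ t' < t + 1, Step n m k T L s t' → pairBit n H' s t' = true) hN he' .s .t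
        (by simpa [dims] using hs) (by simpa [dims] using ht)
      refine Triple.seq ((Triple.assignAt .ex fun _ => false).weakenAt ?_) (Triple.seq hex
        (Triple.onlyIfAt (hset.weakenAt ?_) ?_)) μ
        (show At n m k T (fun fl H' => (fl .ok = true ↔ φ) ∧ H' = H) μ from ⟨H, hH, hD, hok, rfl⟩)
      · rintro fl H' _ ⟨h₁, rfl⟩
        exact ⟨by simp, by simpa using h₁, rfl⟩
      · rintro fl H' _ ⟨⟨h₁, h₂, rfl⟩, h₃⟩
        have hst : Step n m k T (fun u v => pairBit n H' u v = true) s t := by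
          simpa using h₁.1 h₃
        have hpair (u v : ℕ) (hv : v < n) := pairBit_set (u := u) hH hs ht hv
        have hse : update (update e .s s) .t t .s = s := by simp
        rw [hse, update_self]
        refine ⟨h₂, fun u hu v hv => ?_, fun u hu v hv h => ?_, fun v hv h => ?_⟩
        · rw [hpair u v hv]
          refine ⟨fun h => Or.inr ((hLR u hu v hv).1 h), ?_⟩
          rintro (⟨rfl, rfl⟩ | h)
          · exact hR u hu v hv (hst.mono fun a ha b hb => (hLR a ha b hb).2)
          · exact (hLR u hu v hv).2 h
        · rw [hpair u v hv]
          exact Or.inr (hs' u hu v hv h)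
        · rw [hpair s v (lt_of_le_of_lt (Nat.lt_succ_iff.1 hv) ht)]
          rcases Nat.lt_succ_iff_lt_or_eq.1 hv with hv' | rfl
          · exact Or.inr (ht' v hv' h)
          · exact Or.inl ⟨rfl, rfl⟩
      · rintro fl H' ⟨h₁, h₂, rfl⟩ h₃
        have hst : ¬ Step n m k T (fun u v => pairBit n H' u v = true) s t := by
          intro h
          have := h₁.2 (Or.inr (by simpa using h))
          simp [this] at h₃
        refine ⟨h₂, hLR, hs', fun v hv h => ?_⟩
        rcases Nat.lt_succ_iff_lt_or_eq.1 hv with hv' | rfl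
        · exact ht' v hv' h
        · exact absurd (h.mono fun a ha b hb => (hLR a ha b hb).1) hst
    · rintro fl H ⟨h₁, h₂, h₃, h₄⟩
      refine ⟨h₁, h₂, fun s' hs' t ht h => ?_⟩
      rcases Nat.lt_succ_iff_lt_or_eq.1 hs' with hs' | rfl
      · exact h₃ s' hs' t ht h
      · exact h₄ t ht h
  · rintro fl H ⟨h₁, h₂, h₃⟩
    refine ⟨h₁, fun u hu v hv => ⟨?_, (h₂ u hu v hv).2⟩⟩
    rintro (h | h)
    · exact (h₂ u hu v hv).1 h
    · exact h₃ u hu v hv h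

/-- The pairs of states marked after `j` rounds: from them adaptive experiments of length `j`
lead to a known state. -/
def Stage (n m k : ℕ) (T : List Bool) : ℕ → ℕ → ℕ → Prop
  | 0 => fun s t => s = t
  | j + 1 => fun s t => Stage n m k T j s t ∨ Step n m k T (Stage n m k T j) s t

/-- Mark pairs in `n * n` rounds. -/
noncomputable def rounds : TimedProg := forVar .a (forVar .b round)

/-- Two nested loops of length `n` count to `n * n`; after `a` outer and `b` inner rounds the lower
bound is the stage `a * n + b`. -/
theorem triple_rounds (hN : IsBound n m k T N) {R : ℕ → ℕ → Prop} (φ : Prop)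
    (hR : ∀ s < n, ∀ t < n, Step n m k T R s t → R s t) :
    Triple N (dims n m k) 0
      (At n m k T fun fl H => (fl .ok = true ↔ φ) ∧ Between n (Stage n m k T 0) R H) rounds
      (At n m k T fun fl H => (fl .ok = true ↔ φ) ∧
        Between n (Stage n m k T (n * n)) R H) := by
  refine Triple.forVarAt (I := fun w fl H => (fl .ok = true ↔ φ) ∧
    Between n (Stage n m k T (w * n)) R H) hN rfl (fun a ha => ?_)
    (fun fl H h => by simpa using h) fun fl H h => h
  refine Triple.forVarAt (I := fun w fl H => (fl .ok = true ↔ φ) ∧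
    Between n (Stage n m k T (a * n + w)) R H) hN rfl (fun b hb => ?_)
    (fun fl H h => by simpa using h) fun fl H h => by rwa [Nat.succ_mul]
  exact triple_round hN (update_le_dims (update_le_dims (zero_le_dims n m k) ha) hb) rfl rfl rfl
    rfl rfl rfl φ hR

/-- All checks of a complete table. -/
noncomputable def checks : TimedProg :=
  markDiagonal.seq (checkComplete.seq (checkObservable.seq (rounds.seq checkPairs)))

/-- By `hR` the stage `n * n` is closed under `Step`, so it can serve as the upper bound for the
rounds. It is also the lower bound they reach, so the final marks are exactly this stage. -/
theorem triple_checks (hN : IsBound n m k T N) (φ : Prop)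
    (hR : ∀ s < n, ∀ t < n, Step n m k T (Stage n m k T (n * n)) s t →
      Stage n m k T (n * n) s t) :
    Triple N (dims n m k) 0
      (At n m k T fun fl H => (fl .ok = true ↔ φ) ∧ ∀ u < n, ∀ v < n, pairBit n H u v = false)
      checks
      (At n m k T fun fl _ => fl .ok = true ↔ φ ∧
        (∀ s < n, ∀ i < m, ∃ o < k, ∃ u < n, transBit n m k T s i o u = true) ∧
        (∀ s < n, ∀ i < m, ∀ o < k, ∀ u < n, ∀ v < n, transBit n m k T s i o u = true →
          transBit n m k T s i o v = true → u = v) ∧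
        ∀ s < n, ∀ t < n, Stage n m k T (n * n) s t) := by
  have hzero (j u : ℕ) : Stage n m k T j u u := by
    induction j with
    | zero => rfl
    | succ j ih => exact Or.inl ih
  refine (triple_markDiagonal hN _).seq ((andsTo_checkComplete hN _ φ).seq ?_)
  -- The tables before the observability check and after the rounds are named, since the formulas
  -- computed by the checks refer to them.
  rintro μ ⟨H, hH, hD, hok, hdiag⟩
  obtain ⟨μ', ⟨H', hH', hD', hok', -, rfl⟩, h⟩ := andsTo_checkObservable hN H _ μ
    ⟨H, hH, hD, hok, trivial, rfl⟩
  obtain ⟨μ₂, ⟨H₂, hH₂, hD₂, hok₂, hB⟩, h₂⟩ := triple_rounds hN _ hR μ'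
    ⟨H', hH', hD', hok', fun u hu v hv =>
      ⟨(hdiag u hu v hv).2, fun h => (hdiag u hu v hv).1 h ▸ hzero _ _⟩⟩
  obtain ⟨μ₃, ⟨H₃, hH₃, hD₃, hok₃, rfl⟩, h₃⟩ := andsTo_checkPairs hN H₂ _ μ₂
    ⟨H₂, hH₂, hD₂, hok₂, rfl⟩
  refine ⟨μ₃, ⟨H₃, hH₃, hD₃, ?_⟩, (h.seq (h₂.seq h₃)).mono ?_⟩
  · refine hok₃.trans ?_
    rw [and_assoc, and_assoc]
    refine and_congr_right fun _ => and_congr_right fun _ => and_congr ?_ ?_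
    · refine forall₂_congr fun s hs => forall₂_congr fun i hi => forall₂_congr fun o ho =>
        forall₂_congr fun u hu => forall₂_congr fun v hv => ?_
      -- Only the diagonal is marked at this point, so a mark expresses equality.
      rw [hdiag u hu v hv]
    · exact forall₂_congr fun s hs => forall₂_congr fun t ht =>
        ⟨(hB s hs t ht).2, (hB s hs t ht).1⟩
  · simp [TimedProg.seq]

/-! ### Reading the input -/

/-- The number of ones with which a word starts. -/
def ones (w : List Bool) : ℕ := (w.takeWhile id).length

/-- What remains of a word after a number in unary and the bit that closes it. -/
def rest (w : List Bool) : List Bool := (w.dropWhile id).tail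

/-- Is the number in unary with which a word starts closed by a zero? -/
def closed (w : List Bool) : Bool := (w.dropWhile id).head? == some false

/-- Increase the bounds of the loop variables in a list. -/
def pushBounds : List Var → Prog
  | [] => clearTop
  | x :: l => .seq (.push (.hi x) fun _ => true) (pushBounds l)

theorem runs_pushBounds (l : List Var) (c : Option Bool) (fl : Flag → Bool)
    (D : Dat → List Bool) : ∀ d : Var → ℕ, Runs (pushBounds l) ((c, fl), stk d 0 D) (l.length + 1)
      ((none, fl), stk (fun y => d y + l.count y) 0 D) := by
  induction l with
  | nil => exact fun d => (runs_clearTop _ _ _).mono (by simp)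
  | cons x l ih =>
    intro d
    have hst : update (stk d 0 D) (.hi x) (true :: stk d 0 D (.hi x)) =
        stk (fun y => d y + [x].count y) 0 D := by
      ext1 k
      cases k with
      | lo y => simp [stk]
      | hi y =>
        by_cases hy : y = x
        · subst hy
          simp [stk, List.replicate_succ]
        · simp [stk, hy, Ne.symm hy]
      | dat k => simp [stk]
    have hpush := Runs.push (.hi x) (fun _ : Reg => true) (c, fl) (stk d 0 D)
    rw [hst] at hpush
    refine (hpush.seq (ih _)).of_eq ?_ ?_
    · refine congrArg (fun d => ((none, fl), stk d 0 D)) ?_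
      ext1 y
      rw [show x :: l = [x] ++ l from rfl, List.count_append, add_assoc]
    · simp only [List.length_cons]
      omega

/-- Read a number in unary as the bound of the loop variables in the list `l`. -/
def readBounds (l : List Var) : Prog :=
  .seq (popTop (.dat .inp)) (.seq
    (.loop (fun v => v.1 == some true) (.seq (pushBounds l) (popTop (.dat .inp))))
    (.load fun v => (none, update v.2 .ok (v.2 .ok && v.1 == some false))))

/-- In the loop the register holds the first bit of the remaining word and `.inp` holds its tail.
The loop stops at a closing `false` or at the end of the word. The latter clears `.ok`, but the
computation continues with the number read. -/
theorem runs_readBounds (l : List Var) (d : Var → ℕ) (fl : Flag → Bool) (D : Dat → List Bool) :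
    Runs (readBounds l) (conf d 0 ⟨fl, D⟩) ((D .inp).length * (l.length + 3) + 3)
      (conf (fun y => d y + ones (D .inp) * l.count y) 0
        ⟨update fl .ok (fl .ok && closed (D .inp)), update D .inp (rest (D .inp))⟩) := by
  have hloop : ∀ (w : List Bool) (d : Var → ℕ), Runs
      (.loop (fun v : Reg => v.1 == some true) (.seq (pushBounds l) (popTop (.dat .inp))))
      ((w.head?, fl), stk d 0 (update D .inp w.tail)) (w.length * (l.length + 3) + 1)
      (((w.dropWhile id).head?, fl),
        stk (fun y => d y + ones w * l.count y) 0 (update D .inp (rest w))) := by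
    intro w
    induction w with
    | nil =>
      intro d
      refine (Runs.loop_false ?_).of_eq ?_ ?_
      · simp
      · simp [ones, rest]
      · simp
    | cons x w ih =>
      intro d
      cases x with
      | false =>
        refine (Runs.loop_false ?_).of_eq ?_ ?_
        · simp
        · simp [ones, rest]
        · simp
      | true =>
        have hpop := runs_popTop (.dat .inp) none fl
          (stk (fun y => d y + l.count y) 0 (update D .inp w))
        rw [update_stk_dat] at hpop
        simp only [stk, update_self, update_idem] at hpop
        refine (Runs.loop_true ?_ ((runs_pushBounds l _ _ _ _).seq hpop) (ih _)).of_eq ?_ ?_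
        · simp
        · simp only [ones, rest, List.dropWhile_cons, List.takeWhile_cons, id, if_true,
            List.length_cons]
          refine congrArg (fun d => ((_, fl), stk d 0 _)) ?_
          ext1 y
          ring
        · simp only [List.length_cons]
          ring_nf
          omega
  have hpop := runs_popTop (.dat .inp) none fl (stk d 0 D)
  rw [update_stk_dat] at hpop
  refine (hpop.seq ((hloop (D .inp) d).seq (Runs.load _ _ _))).of_eq rfl ?_
  ring_nf
  omega

/-! ### Preparing the tables -/

/-- Check that the bound of the loop variable `x` is positive. -/
noncomputable def checkPositive (x : Var) : TimedProg :=
  ⟨.seq (peekTop (.hi x)) (.load fun v => (none, update v.2 .ok (v.2 .ok && v.1.isSome))), 2⟩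

theorem triple_checkPositive {N : ℕ} {d : Var → ℕ} (x : Var) {fl : Flag → Bool}
    {D : Dat → List Bool} :
    Triple N d 0 (· = ⟨fl, D⟩) (checkPositive x)
      (· = ⟨update fl .ok (fl .ok && decide (0 < d x)), D⟩) := by
  rintro _ rfl
  refine ⟨_, rfl, ((runs_peekTop _ _ _ _).seq (Runs.load _ _ _)).of_eq ?_ ?_⟩
  · have : (stk d 0 D (.hi x)).head?.isSome = decide (0 < d x) := by
      rcases h : d x with _ | j
      · simp [stk, h]
      · simp [stk, h, List.replicate_succ]
    simp only [conf, this]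
  · simp [checkPositive]

theorem triple_pushDat {N : ℕ} {d e : Var → ℕ} {k : Dat} {b : Bool} {fl : Flag → Bool}
    {D : Dat → List Bool} (j : ℕ) :
    Triple N d e (· = ⟨fl, update D k (List.replicate j b)⟩) (pushDat k b)
      (· = ⟨fl, update D k (List.replicate (j + 1) b)⟩) := by
  refine (Triple.pushDat k b).weaken ?_ fun _ h => h
  rintro _ rfl
  simp [List.replicate_succ]

/-- Move a bit of the input to the auxiliary stack, checking that it exists. -/
noncomputable def checkedMove : TimedProg :=
  ⟨.seq (popTop (.dat .inp)) (.ite hasTop (.seq (pushTop (.dat .aux)) clearTop)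
    (.load fun v => (none, update v.2 .ok false))), 4⟩

/-- The memory after `j` checked moves. -/
def movedMem (fl : Flag → Bool) (D : Dat → List Bool) (T : List Bool) (j : ℕ) : Mem :=
  ⟨update fl .ok (fl .ok && decide (j ≤ T.length)),
    update (update D .inp (T.drop j)) .aux (T.take j).reverse⟩

/-- A missing bit clears `.ok` and leaves the stacks unchanged, as `movedMem` says for `j` beyond
the length of `T`. -/
theorem triple_checkedMove {N : ℕ} {d e : Var → ℕ} {fl : Flag → Bool} {D : Dat → List Bool}
    {T : List Bool} (j : ℕ) :
    Triple N d e (· = movedMem fl D T j) checkedMove (· = movedMem fl D T (j + 1)) := by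
  rintro _ rfl
  refine ⟨_, rfl, ?_⟩
  have hpop := runs_popTop (.dat .inp) none (movedMem fl D T j).flag
    (stk d e (movedMem fl D T j).dat)
  rw [update_stk_dat] at hpop
  have hinp : stk d e (movedMem fl D T j).dat (.dat .inp) = T.drop j := by
    simp [stk, movedMem]
  rw [hinp] at hpop
  rcases hT : T.drop j with _ | ⟨x, l⟩
  · rw [hT] at hpop
    have hj : T.length ≤ j := List.drop_eq_nil_iff.1 hT
    refine (hpop.seq (Runs.ite_false rfl (Runs.load _ _ _))).of_eq ?_ ?_
    · have h1 : T.drop (j + 1) = [] := List.drop_eq_nil_iff.2 (by omega)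
      have h2 : T.take (j + 1) = T.take j := by
        rw [List.take_of_length_le hj, List.take_of_length_le (by omega)]
      have h3 : ¬ j + 1 ≤ T.length := by omega
      simp only [conf, movedMem, h1, h2, h3, decide_false, Bool.and_false, update_idem,
        List.tail_nil]
      rw [update_comm (by decide), update_idem, update_comm (by decide)]
    · simp [checkedMove]
  · rw [hT] at hpop
    have hj : j < T.length := by
      by_contra h
      simp [List.drop_eq_nil_iff.2 (not_lt.1 h)] at hT
    refine (hpop.seq (Runs.ite_true rfl ((runs_pushTop (.dat .aux) x _ _).seq
      (runs_clearTop _ _ _)))).of_eq ?_ ?_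
    · have h1 : T.drop (j + 1) = l := by
        rw [← List.tail_drop, hT, List.tail_cons]
      have h2 : T.take (j + 1) = T.take j ++ [x] := by
        rw [List.take_add, hT]
        rfl
      rw [update_stk_dat]
      simp only [conf, movedMem, h1, h2, hj.le, Nat.succ_le_of_lt hj, List.tail_cons, stk,
        List.reverse_append, List.reverse_cons, List.reverse_nil, List.nil_append,
        List.singleton_append]
      rw [update_comm (show Dat.aux ≠ .inp by decide), update_idem, update_self, update_idem]
    · simp [checkedMove]

/-- Check that the length of the input is the product of the bounds of its indices. -/
noncomputable def checkLength : TimedProg :=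
  (forVar .s (forVar .i (forVar .o (forVar .u checkedMove)))).seq
    ⟨.seq (peekTop (.dat .inp)) (.seq
      (.load fun v => (none, update v.2 .ok (v.2 .ok && v.1.isNone)))
      (pour (.dat .aux) (.dat .inp))), 3 * X + 4⟩

/-- All moves find a bit if and only if the table is long enough, and no bit is left over if and
only if it is not too long. -/
theorem triple_checkLength {n m k N : ℕ} {T : List Bool} (hN : IsBound n m k T N)
    {fl : Flag → Bool} {D : Dat → List Bool} (hinp : D .inp = T) (haux : D .aux = []) :
    Triple N (dims n m k) 0 (· = ⟨fl, D⟩) checkLength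
      (· = ⟨update fl .ok (fl .ok && decide (T.length = n * (m * (k * n)))), D⟩) := by
  have hcount := Triple.forVar_count (N := N) (d := dims n m k) (e := 0) (x := .s)
    (μ := movedMem fl D T) (a := m * (k * (n * 1))) rfl (hN.dims _) (fun v => Triple.forVar_count
      (x := .i) rfl (hN.dims _) (fun _ => Triple.forVar_count (x := .o) rfl (hN.dims _) (fun _ =>
        Triple.forVar_count (x := .u) rfl (hN.dims _) fun _ => triple_checkedMove))) 0
  rw [mul_one, zero_add] at hcount
  change Triple N (dims n m k) 0 (· = movedMem fl D T 0) _
    (· = movedMem fl D T (n * (m * (k * n)))) at hcount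
  set L := n * (m * (k * n)) with hL
  have hzero : movedMem fl D T 0 = ⟨fl, D⟩ := by
    have h1 : update fl .ok (fl .ok) = fl := update_eq_self _ _
    simp only [movedMem, Nat.zero_le, decide_true, Bool.and_true, List.drop_zero, List.take_zero,
      List.reverse_nil, h1]
    rw [← hinp, ← haux, update_eq_self, update_eq_self]
  rw [hzero] at hcount
  refine hcount.seq ?_
  rintro _ rfl
  refine ⟨_, rfl, ((runs_peekTop _ _ _ _).seq ((Runs.load _ _ _).seq
    (runs_pour (by decide) _ _ _))).of_eq ?_ ?_⟩
  · have hflag : (decide (L ≤ T.length) && (T.drop L).head?.isNone) =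
        decide (T.length = L) := by
      rw [Bool.eq_iff_iff]
      simp only [Bool.and_eq_true, decide_eq_true_eq, Option.isNone_iff_eq_none,
        List.head?_eq_none_iff, List.drop_eq_nil_iff]
      omega
    have hdat : update (update (movedMem fl D T L).dat .aux []) .inp
        ((T.take L).reverse.reverse ++ T.drop L) = D := by
      rw [List.reverse_reverse, List.take_append_drop, ← hinp, ← haux]
      simp only [movedMem, update_idem]
      rw [update_comm (by decide), update_idem, update_comm (by decide), update_eq_self,
        update_eq_self]
    have hst (a : Dat) : stk (dims n m k) 0 (movedMem fl D T L).dat (.dat a) =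
        (movedMem fl D T L).dat a := rfl
    have hauxL : (movedMem fl D T L).dat .aux = (T.take L).reverse := by simp [movedMem]
    have hinpL : (movedMem fl D T L).dat .inp = T.drop L := by simp [movedMem]
    rw [update_stk_dat, update_stk_dat, hst, hst, hauxL, hinpL, hdat]
    simp only [conf, movedMem, update_self, update_idem, Bool.and_assoc, hflag]
  · have : (stk (dims n m k) 0 (movedMem fl D T L).dat (.dat .aux)).length ≤ N := by
      simp only [stk, movedMem, update_self, List.length_reverse, List.length_take]
      exact (min_le_right _ _).trans hN.table
    simp only [eval_add, eval_mul, eval_X, eval_ofNat]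
    omega

/-- Fill the data stacks with the strides and the empty table of pairs. -/
noncomputable def fillTables : TimedProg :=
  (pushDat .one true).seq ((forVar .s (pushDat .strideO true)).seq
    ((forVar .o (forVar .s (pushDat .strideI true))).seq
      ((forVar .i (forVar .o (forVar .s (pushDat .strideS true)))).seq
        (forVar .s (forVar .t (pushDat .tab false))))))

/-- Products in unary arise from nested loops around a single push, counted by
`Triple.forVar_count`. -/
theorem triple_fillTables {n m k N : ℕ} {T : List Bool} (hN : IsBound n m k T N)
    {fl : Flag → Bool} :
    Triple N (dims n m k) 0 (· = ⟨fl, update (fun _ => []) .inp T⟩) fillTables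
      (· = ⟨fl, store n m k T (List.replicate (n * n) false)⟩) := by
  have hstart (D : Dat → List Bool) (j : Dat) (b : Bool) (hD : D j = []) :
      (⟨fl, update D j (List.replicate 0 b)⟩ : Mem) = ⟨fl, D⟩ := by
    rw [List.replicate_zero, ← hD, update_eq_self]
  have h₁ (D : Dat → List Bool) (hD : D .one = []) := triple_pushDat (N := N) (d := dims n m k)
    (e := 0) (k := .one) (b := true) (fl := fl) (D := D) 0
  have h₂ (D : Dat → List Bool) (hD : D .strideO = []) := Triple.forVar_count (N := N)
    (d := dims n m k) (e := 0) (x := .s) (a := 1) rfl (hN.dims _)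
    (fun _ => triple_pushDat (k := .strideO) (b := true) (fl := fl) (D := D)) 0
  have h₃ (D : Dat → List Bool) (hD : D .strideI = []) := Triple.forVar_count (N := N)
    (d := dims n m k) (e := 0) (x := .o) (a := n * 1) rfl (hN.dims _)
    (fun _ => Triple.forVar_count (x := .s) rfl (hN.dims _)
      (fun _ => triple_pushDat (k := .strideI) (b := true) (fl := fl) (D := D))) 0
  have h₄ (D : Dat → List Bool) (hD : D .strideS = []) := Triple.forVar_count (N := N)
    (d := dims n m k) (e := 0) (x := .i) (a := k * (n * 1)) rfl (hN.dims _)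
    (fun _ => Triple.forVar_count (x := .o) rfl (hN.dims _)
      (fun _ => Triple.forVar_count (x := .s) rfl (hN.dims _)
        (fun _ => triple_pushDat (k := .strideS) (b := true) (fl := fl) (D := D)))) 0
  have h₅ (D : Dat → List Bool) (hD : D .tab = []) := Triple.forVar_count (N := N)
    (d := dims n m k) (e := 0) (x := .s) (a := n * 1) rfl (hN.dims _)
    (fun _ => Triple.forVar_count (x := .t) rfl (hN.dims _)
      (fun _ => triple_pushDat (k := .tab) (b := false) (fl := fl) (D := D))) 0
  simp +contextual only [hstart, zero_add, mul_one] at h₁ h₂ h₃ h₄ h₅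
  refine ((h₁ _ (by simp)).seq ((h₂ _ (by simp)).seq ((h₃ _ (by simp)).seq ((h₄ _ (by simp)).seq
    (h₅ _ (by simp)))))).weaken (fun _ h => h) ?_
  · rintro _ rfl
    congr 1
    ext1 j
    cases j <;> simp [store, dims]

end HomingMachine

/-! ### Reduction of homing to pairs of states -/

namespace FSM

/-- The states `s` and `t` can be merged or told apart by an adaptive experiment. -/
inductive PairHoming {S I O : Type*} (M : FSM S I O) : S → S → Prop
  | refl (s : S) : M.PairHoming s s
  | step {s t : S} (i : I)
      (h : ∀ o s' t', M.trans s i o s' → M.trans t i o t' → M.PairHoming s' t') :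
      M.PairHoming s t

section

variable {S I O Q : Type*} {M : FSM S I O}

theorem Observable.successor_cons (hM : M.Observable) {s s' : S} {i : I} {o : O}
    (h : M.trans s i o s') (γ : List (I × O)) :
    M.successor s ((i, o) :: γ) = M.successor s' γ := by
  ext t
  constructor
  · rintro ⟨u, hu, ht⟩
    obtain rfl := hM _ _ _ _ _ h hu
    exact ht
  · exact fun ht => ⟨s', h, ht⟩

/-- A finite machine without cycles is well-founded along its transitions. -/
theorem Acyclic.wellFounded [Finite Q] {P : FSM Q I O} (hP : P.Acyclic) :
    WellFounded fun q p => P.Edge p q := by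
  have : IsTrans Q (fun q p => Relation.TransGen P.Edge p q) := ⟨fun _ _ _ h h' => h'.trans h⟩
  have : Std.Irrefl (fun q p => Relation.TransGen P.Edge p q) := ⟨hP⟩
  exact Subrelation.wf (fun h => Relation.TransGen.single h)
    (Finite.wellFounded_of_trans_of_irrefl fun q p => Relation.TransGen P.Edge p q)

/-- Well-founded induction on the states of the test case, each regarded as initial. At a deadlock
the empty trace forces `s = t`. Elsewhere output-completeness provides a next state for every
output, from which the pair of successors is homed. -/
theorem IsTestCase.pairHoming {P : FSM Q I O} {p₀ : Q} (hP : P.IsTestCase p₀)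
    (hM : M.Observable) (p : Q) : ∀ s t : S, P.IsHomingFor p M {s, t} → M.PairHoming s t := by
  have := hP.finite
  induction p using hP.acyclic.wellFounded.induction with
  | _ p ih =>
    intro s t h
    by_cases hd : P.Deadlock p
    · obtain ⟨u, hu⟩ := h [] p rfl hd
      have key : ∀ s' ∈ ({s, t} : Set S), s' = u := by
        intro s' hs'
        have hself : s' ∈ M.successor s' [] := rfl
        rcases hu s' hs' with h | h
        · simp [h] at hself
        · simpa [h] using hself
      obtain rfl := key s (by simp)
      obtain rfl := key t (by simp)
      exact .refl _
    · simp only [Deadlock, not_forall, not_not] at hd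
      obtain ⟨i, hi⟩ := hd
      refine .step i fun o s' t' hs ht => ?_
      obtain ⟨p', hp'⟩ := hP.outputComplete p i hi o
      refine ih p' ⟨i, o, hp'⟩ s' t' fun γ d hγ hd => ?_
      obtain ⟨u, hu⟩ := h ((i, o) :: γ) d ⟨p', hp', hγ⟩ hd
      refine ⟨u, ?_⟩
      rintro x (rfl | rfl)
      · simpa [hM.successor_cons hs] using hu s (by simp)
      · simpa [hM.successor_cons ht] using hu t (by simp)

theorem AdaptivelyHoming.pairHoming (h : M.AdaptivelyHoming) (hM : M.Observable) (s t : S) :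
    M.PairHoming s t := by
  obtain ⟨Q, P, p₀, hP, hh⟩ := h
  refine hP.pairHoming hM p₀ s t fun γ d hγ hd => ?_
  obtain ⟨u, hu⟩ := hh γ d hγ hd
  exact ⟨u, fun s' _ => hu s' trivial⟩

end

/-! ### Test cases from decision trees -/

/-- Adaptive experiments as trees. -/
inductive Experiment (I O : Type) : Type
  | leaf
  | apply (i : I) (next : O → Experiment I O)

namespace Experiment

variable {I O : Type}

/-- The machine whose states are all experiments. -/
def machine (I O : Type) : FSM (Experiment I O) I O where
  trans x i o y := ∃ next, x = apply i next ∧ y = next o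

theorem machine_edge_apply {i : I} {next : O → Experiment I O} {y : Experiment I O} :
    (machine I O).Edge (apply i next) y ↔ ∃ o, y = next o := by
  constructor
  · rintro ⟨j, o, next', h, rfl⟩
    cases h
    exact ⟨o, rfl⟩
  · rintro ⟨o, rfl⟩
    exact ⟨i, o, next, rfl, rfl⟩

theorem not_machine_edge_stop {y : Experiment I O} : ¬ (machine I O).Edge leaf y := by
  rintro ⟨j, o, next', h, -⟩
  cases h

/-- Experiments are inductive trees, and each edge leads to an immediate subtree. -/
theorem machine_acyclic : (machine I O).Acyclic := by
  have hwf : WellFounded fun q p => (machine I O).Edge p q := by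
    refine ⟨fun x => ?_⟩
    induction x with
    | leaf => exact ⟨_, fun y hy => absurd hy not_machine_edge_stop⟩
    | apply i next ih =>
      refine ⟨_, fun y hy => ?_⟩
      obtain ⟨o, rfl⟩ := machine_edge_apply.1 hy
      exact ih o
  intro x hx
  rw [← Relation.transGen_swap] at hx
  exact hwf.transGen.irrefl.irrefl x hx

/-- With finitely many outputs the tree is finitely branching and well-founded, so it has finitely
many subtrees. -/
theorem finite_reachable [Finite O] (x : Experiment I O) :
    {y | Relation.ReflTransGen (machine I O).Edge x y}.Finite := by
  induction x with
  | leaf =>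
    refine (Set.finite_singleton leaf).subset fun y hy => ?_
    rcases Relation.ReflTransGen.cases_head hy with h | ⟨z, hz, -⟩
    · exact h.symm
    · exact absurd hz not_machine_edge_stop
  | apply i next ih =>
    refine ((Set.finite_singleton (apply i next)).union (Set.finite_iUnion ih)).subset
      fun y hy => ?_
    rcases Relation.ReflTransGen.cases_head hy with h | ⟨z, hz, hzy⟩
    · exact Or.inl h.symm
    · obtain ⟨o, rfl⟩ := machine_edge_apply.1 hz
      exact Or.inr (Set.mem_iUnion.2 ⟨o, hzy⟩)

/-- The states of the test case of an experiment. -/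
abbrev Node (x : Experiment I O) : Type :=
  {y // Relation.ReflTransGen (machine I O).Edge x y}

/-- The test case of an experiment. -/
def testCase (x : Experiment I O) : FSM x.Node I O where
  trans y i o z := (machine I O).trans y.1 i o z.1

/-- The initial state of the test case of an experiment. -/
def root (x : Experiment I O) : x.Node := ⟨x, .refl⟩

theorem isTestCase [Finite O] (x : Experiment I O) : x.testCase.IsTestCase x.root where
  finite := (finite_reachable x).to_subtype
  initiallyConnected := by
    rintro ⟨y, hy⟩
    induction hy with
    | refl => exact .refl
    | tail h₁ h₂ ih => exact ih.tail h₂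
  singleInput := by
    rintro y i j ⟨o, z, next, h, -⟩ ⟨o', z', next', h', -⟩
    rw [h] at h'
    cases h'
    rfl
  outputComplete := by
    rintro y i ⟨o, z, next, h, -⟩ o'
    exact ⟨⟨next o', y.2.tail ⟨i, o', next, h, rfl⟩⟩, next, h, rfl⟩
  observable := by
    rintro y i o z z' ⟨next, h, hz⟩ ⟨next', h', hz'⟩
    rw [h] at h'
    cases h'
    exact Subtype.ext (hz.trans hz'.symm)
  acyclic := fun y hy => machine_acyclic y.1 (hy.lift Subtype.val fun _ _ h => h)

variable {S : Type*} (M : FSM S I O)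

/-- The states after the response `o` to the input `i` in a state in `A`. -/
def after (A : Set S) (i : I) (o : O) : Set S := {s' | ∃ s ∈ A, M.trans s i o s'}

/-- The experiment brings the machine from each state in `A` to a known state. -/
def Homes : Experiment I O → Set S → Prop
  | leaf, A => ∃ s, A ⊆ {s}
  | apply i next, A => ∀ o, Homes (next o) (after M A i o)

variable {M}

/-- Each letter of the trace replaces the set of possible states by its `after` set, until a leaf
confines it to one state; states that cannot produce the trace have an empty successor. An inner
node is not a deadlock, because some output exists. -/
theorem Homes.exists_of_reaches (hM : M.Observable) {x : Experiment I O} [Nonempty O]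
    (γ : List (I × O)) : ∀ (y d : x.Node) (A : Set S), Homes M y.1 A →
      x.testCase.Reaches y γ d → x.testCase.Deadlock d →
      ∃ s, ∀ s' ∈ A, M.successor s' γ = ∅ ∨ M.successor s' γ = {s} := by
  induction γ with
  | nil =>
    rintro ⟨y, hy⟩ d A hA rfl hd
    cases y with
    | leaf =>
      obtain ⟨s, hs⟩ := hA
      refine ⟨s, fun s' hs' => Or.inr ?_⟩
      obtain rfl := hs hs'
      ext t
      exact eq_comm
    | apply i next =>
      obtain ⟨o⟩ := ‹Nonempty O›
      exact absurd ⟨o, ⟨next o, hy.tail ⟨i, o, next, rfl, rfl⟩⟩, next, rfl, rfl⟩ (hd i)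
  | cons io γ ih =>
    rintro ⟨y, hy⟩ d A hA ⟨u, ⟨next, hyn, hu⟩, hr⟩ hd
    simp only at hyn
    subst hyn
    obtain ⟨s, hs⟩ := ih u d (after M A io.1 io.2) (hu ▸ hA io.2) hr hd
    refine ⟨s, fun s' hs' => ?_⟩
    by_cases hex : ∃ t, M.trans s' io.1 io.2 t
    · obtain ⟨t, ht⟩ := hex
      rw [show io :: γ = (io.1, io.2) :: γ from rfl, hM.successor_cons ht]
      exact hs t ⟨s', hs', ht⟩
    · refine Or.inl (Set.eq_empty_of_forall_notMem ?_)
      rintro t ⟨v, hv, -⟩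
      exact hex ⟨v, hv⟩

theorem Homes.homingSet [Finite O] [Nonempty O] (hM : M.Observable) {x : Experiment I O}
    {A : Set S} (h : Homes M x A) : M.HomingSet A :=
  ⟨x.Node, x.testCase, x.root, x.isTestCase, fun γ d hγ hd =>
    h.exists_of_reaches hM γ x.root d A hγ hd⟩

/-- Choose a predecessor in `A` for each state reached. By observability it determines that state,
so the choice is injective. -/
theorem ncard_after_le [Finite S] (hM : M.Observable) (A : Set S) (i : I) (o : O) :
    (after M A i o).ncard ≤ A.ncard := by
  choose! g hg using fun (s' : S) (h : s' ∈ after M A i o) => h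
  exact Set.ncard_le_ncard_of_injOn g (fun s' h => (hg s' h).1)
    fun s' h t' h' e => hM _ _ _ _ _ (hg s' h).2 (e ▸ (hg t' h').2)

/-- Fewer states remain unless both of two states have distinct successors. -/
theorem ncard_after_lt [Finite S] (hM : M.Observable) {A : Set S} {i : I} {o : O} {s t : S}
    (hs : s ∈ A) (ht : t ∈ A) (hst : s ≠ t)
    (h : ∀ s' t', M.trans s i o s' → M.trans t i o t' → s' = t') :
    (after M A i o).ncard < A.ncard := by
  choose! g hg using fun (s' : S) (h : s' ∈ after M A i o) => h
  -- Some member of `A` is not a chosen predecessor: if both `s` and `t` were, their successors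
  -- would agree by `h`, and so would `s` and `t`.
  obtain ⟨a, ha, hga⟩ : ∃ a ∈ A, ∀ s' ∈ after M A i o, g s' ≠ a := by
    by_contra! hcon
    obtain ⟨s', hs', rfl⟩ := hcon s hs
    obtain ⟨t', ht', rfl⟩ := hcon t ht
    exact hst (congrArg g (h s' t' (hg s' hs').2 (hg t' ht').2))
  refine lt_of_le_of_lt (b := (A \ {a}).ncard) ?_ (Set.ncard_sdiff_singleton_lt_of_mem ha)
  exact Set.ncard_le_ncard_of_injOn g (fun s' h => ⟨(hg s' h).1, hga s' h⟩)
    fun s' h t' h' e => hM _ _ _ _ _ (hg s' h).2 (e ▸ (hg t' h').2)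

/-- The inner induction, along the experiment for a pair of distinct states in `A`. If an output
leads both to distinct successors, the experiment continues with a set that is no larger; any other
output removes a state, and `hc` applies. -/
theorem exists_homes_of_pairHoming [Finite S] (hM : M.Observable) {c : ℕ}
    (hc : ∀ B : Set S, B.ncard < c → ∃ x, Homes M x B) {s t : S} (h : M.PairHoming s t) :
    ∀ A : Set S, A.ncard ≤ c → s ∈ A → t ∈ A → s ≠ t → ∃ x, Homes M x A := by
  induction h with
  | refl => exact fun _ _ _ _ h => absurd rfl h
  | @step s t i _ ih =>
    intro A hA hs ht hst
    have key (o : O) : ∃ x, Homes M x (after M A i o) := by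
      by_cases hd : ∃ s' t', M.trans s i o s' ∧ M.trans t i o t' ∧ s' ≠ t'
      · obtain ⟨s', t', hs', ht', hne⟩ := hd
        exact ih o s' t' hs' ht' _ ((ncard_after_le hM A i o).trans hA) ⟨s, hs, hs'⟩ ⟨t, ht, ht'⟩
          hne
      · push Not at hd
        exact hc _ ((ncard_after_lt hM hs ht hst hd).trans_le hA)
    choose next hnext using key
    exact ⟨apply i next, hnext⟩

/-- The outer induction, on the number of possible states. As long as two distinct states remain,
the experiment for such a pair is used. A leaf needs some state as its witness even for the empty
set, whence `Nonempty S`. -/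
theorem exists_homes [Finite S] [Nonempty S] (hM : M.Observable) (h : ∀ s t, M.PairHoming s t)
    (c : ℕ) : ∀ A : Set S, A.ncard ≤ c → ∃ x, Homes M x A := by
  induction c with
  | zero =>
    intro A hA
    obtain ⟨s⟩ := ‹Nonempty S›
    have : A = ∅ := (Set.ncard_eq_zero).1 (by omega)
    exact ⟨leaf, s, by simp [this]⟩
  | succ c ih =>
    intro A hA
    by_cases hsub : A.Subsingleton
    · rcases hsub.eq_empty_or_singleton with rfl | ⟨s, rfl⟩
      · exact ih ∅ (by simp)
      · exact ⟨leaf, s, subset_rfl⟩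
    · rw [Set.not_subsingleton_iff] at hsub
      obtain ⟨s, hs, t, ht, hst⟩ := hsub
      exact exists_homes_of_pairHoming hM (fun B hB => ih B (by omega)) (h s t) A hA hs ht hst

end Experiment

/-- A machine is adaptively homing if and only if all pairs of its states are. -/
theorem adaptivelyHoming_iff {S : Type*} {I O : Type} {M : FSM S I O} [Finite S] [Nonempty S]
    [Finite O] [Nonempty O] (hM : M.Observable) :
    M.AdaptivelyHoming ↔ ∀ s t, M.PairHoming s t := by
  refine ⟨fun h => h.pairHoming hM, fun h => ?_⟩
  obtain ⟨x, hx⟩ := Experiment.exists_homes hM h _ Set.univ le_rfl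
  exact hx.homingSet hM

/-- A machine without states is not adaptively homing. -/
theorem AdaptivelyHoming.nonempty {S : Type*} {I O : Type} {M : FSM S I O}
    (h : M.AdaptivelyHoming) : Nonempty S := by
  obtain ⟨Q, P, p₀, hP, hh⟩ := h
  have := hP.finite
  -- Every state of a finite acyclic test case has a trace to a deadlock; the homing condition for
  -- such a trace names a state of `M`.
  have key (p : Q) : ∃ d, P.Deadlock d ∧ ∃ γ, P.Reaches p γ d := by
    induction p using hP.acyclic.wellFounded.induction with
    | _ p ih =>
      by_cases hd : P.Deadlock p
      · exact ⟨p, hd, [], rfl⟩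
      · simp only [Deadlock, not_forall, not_not] at hd
        obtain ⟨i, o, p', hp'⟩ := hd
        obtain ⟨d, hd, γ, hγ⟩ := ih p' ⟨i, o, hp'⟩
        exact ⟨d, hd, (i, o) :: γ, p', hp', hγ⟩
  obtain ⟨d, hd, γ, hγ⟩ := key p₀
  obtain ⟨s, -⟩ := hh γ d hγ hd
  exact ⟨s⟩

end FSM

namespace HomingMachine

open Function Polynomial StackProg TimedProg Turing

/-! ### The code of a machine -/

/-- Blocks of equal length make positions mixed-radix numbers; each application peels off one index
of the transition table. -/
theorem getD_flatMap {α : Type*} {g : α → List Bool} {c : ℕ} (hg : ∀ a, (g a).length = c)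
    {r : ℕ} (hr : r < c) (l : List α) :
    ∀ (j : ℕ) (hj : j < l.length), (l.flatMap g).getD (j * c + r) false =
      (g (l[j])).getD r false := by
  induction l with
  | nil => exact fun j hj => absurd hj (by simp)
  | cons a l ih =>
    intro j hj
    rw [List.flatMap_cons]
    cases j with
    | zero =>
      rw [List.getD_append _ _ _ _ (by rw [hg]; omega)]
      simp
    | succ j =>
      rw [List.getD_append_right _ _ _ _ (by rw [hg, Nat.succ_mul]; omega), hg,
        show (j + 1) * c + r - c = j * c + r by rw [Nat.succ_mul]; omega]
      exact ih j (by simpa using hj)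

section

variable {n m k : ℕ}

open Classical in
/-- The characteristic table of the transition relation. -/
noncomputable def table (M : FSM (Fin n) (Fin m) (Fin k)) : List Bool :=
  (List.finRange n).flatMap fun s =>
    (List.finRange m).flatMap fun i =>
      (List.finRange k).flatMap fun o =>
        (List.finRange n).map fun s' => decide (M.trans s i o s')

/-- The numbers of states, inputs and outputs in unary followed by a word. -/
def withHeader (n m k : ℕ) (T : List Bool) : List Bool :=
  List.replicate n true ++ false :: (List.replicate m true ++
    false :: (List.replicate k true ++ false :: T))

theorem code_eq (M : FSM (Fin n) (Fin m) (Fin k)) : M.code = withHeader n m k (table M) := by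
  simp [FSM.code, withHeader, table]

theorem length_table (M : FSM (Fin n) (Fin m) (Fin k)) :
    (table M).length = n * (m * (k * n)) := by
  simp [table]

theorem mul_add_lt {a c j r : ℕ} (hj : j < a) (hr : r < c) : j * c + r < a * c :=
  calc j * c + r < j * c + c := Nat.add_lt_add_left hr _
    _ = (j + 1) * c := (Nat.succ_mul j c).symm
    _ ≤ a * c := Nat.mul_le_mul_right c hj

open Classical in
theorem transBit_table (M : FSM (Fin n) (Fin m) (Fin k)) (s : Fin n) (i : Fin m) (o : Fin k)
    (s' : Fin n) : transBit n m k (table M) s i o s' = decide (M.trans s i o s') := by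
  have h₁ : (s' : ℕ) < n := s'.2
  have h₂ : (o : ℕ) * n + s' < k * n := mul_add_lt o.2 h₁
  have h₃ : (i : ℕ) * (k * n) + (o * n + s') < m * (k * n) := mul_add_lt i.2 h₂
  unfold transBit table
  rw [add_assoc, add_assoc, getD_flatMap (c := m * (k * n)) (by simp) h₃ _ _ (by simp),
    getD_flatMap (c := k * n) (by simp) h₂ _ _ (by simp),
    getD_flatMap (c := n) (by simp) h₁ _ _ (by simp)]
  simp [List.getD_eq_getElem?_getD]

/-- The machine with a given characteristic table. -/
def tableMachine (n m k : ℕ) (T : List Bool) : FSM (Fin n) (Fin m) (Fin k) where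
  trans s i o s' := transBit n m k T s i o s' = true

open Classical in
theorem tableMachine_table (M : FSM (Fin n) (Fin m) (Fin k)) :
    tableMachine n m k (table M) = M := by
  obtain ⟨f⟩ := M
  refine congrArg FSM.mk ?_
  ext s i o s'
  rw [transBit_table, decide_eq_true_eq]

theorem exists_eq_mul_add {a c x : ℕ} (h : x < a * c) :
    ∃ (j : Fin a) (r : ℕ), r < c ∧ x = j * c + r := by
  have hc : 0 < c := Nat.pos_of_mul_pos_left (Nat.zero_lt_of_lt h)
  exact ⟨⟨x / c, (Nat.div_lt_iff_lt_mul hc).2 h⟩, x % c, Nat.mod_lt _ hc,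
    (Nat.div_add_mod' x c).symm⟩

/-- Each position of a word of the right length has mixed-radix digits `s`, `i`, `o`, `r`. Together
with `tableMachine_table` this makes tables and machines correspond bijectively. -/
theorem table_tableMachine {T : List Bool} (hT : T.length = n * (m * (k * n))) :
    table (tableMachine n m k T) = T := by
  refine List.ext_getElem (by rw [length_table, hT]) fun x h₁ h₂ => ?_
  rw [← List.getD_eq_getElem _ false h₁, ← List.getD_eq_getElem _ false h₂]
  rw [hT] at h₂
  obtain ⟨s, y, hy, rfl⟩ := exists_eq_mul_add h₂
  obtain ⟨i, z, hz, rfl⟩ := exists_eq_mul_add hy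
  obtain ⟨o, r, hr, rfl⟩ := exists_eq_mul_add hz
  have : transBit n m k (table (tableMachine n m k T)) s i o r = transBit n m k T s i o r :=
    (transBit_table _ s i o ⟨r, hr⟩).trans Bool.decide_eq_true
  simpa only [transBit, add_assoc] using this

theorem ones_replicate_append (n : ℕ) (w : List Bool) :
    ones (List.replicate n true ++ false :: w) = n := by
  induction n with
  | zero => simp [ones]
  | succ n ih =>
    simp [ones]

theorem dropWhile_replicate_append (n : ℕ) (w : List Bool) :
    (List.replicate n true ++ false :: w).dropWhile id = false :: w := by
  induction n with
  | zero => simp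
  | succ n ih =>
    simp

theorem rest_replicate_append (n : ℕ) (w : List Bool) :
    rest (List.replicate n true ++ false :: w) = w := by
  rw [rest, dropWhile_replicate_append, List.tail_cons]

theorem closed_replicate_append (n : ℕ) (w : List Bool) :
    closed (List.replicate n true ++ false :: w) = true := by
  rw [closed, dropWhile_replicate_append]
  rfl

theorem eq_of_closed (w : List Bool) (h : closed w = true) :
    w = List.replicate (ones w) true ++ false :: rest w := by
  induction w with
  | nil => simp [closed] at h
  | cons x w ih =>
    cases x with
    | false => simp [ones, rest]
    | true =>
      have := ih (by simpa [closed] using h)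
      simpa [ones, rest, List.replicate_succ] using this

/-- The number of states encoded by a word. -/
def states (w : List Bool) : ℕ := ones w

/-- The number of inputs encoded by a word. -/
def inputs (w : List Bool) : ℕ := ones (rest w)

/-- The number of outputs encoded by a word. -/
def outputs (w : List Bool) : ℕ := ones (rest (rest w))

/-- The characteristic table encoded by a word. -/
def body (w : List Bool) : List Bool := rest (rest (rest w))

theorem eq_withHeader {w : List Bool} (h₁ : closed w = true) (h₂ : closed (rest w) = true)
    (h₃ : closed (rest (rest w)) = true) :
    w = withHeader (states w) (inputs w) (outputs w) (body w) := by
  rw [withHeader, body, states, inputs, outputs, ← eq_of_closed _ h₃, ← eq_of_closed _ h₂,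
    ← eq_of_closed _ h₁]

/-- A number in unary ends at its first zero, so the header can be parsed back. -/
theorem withHeader_injective {n' m' k' : ℕ} {T T' : List Bool}
    (h : withHeader n m k T = withHeader n' m' k' T') : n = n' ∧ m = m' ∧ k = k' ∧ T = T' := by
  have h₁ := congrArg rest h
  have h₂ := congrArg rest h₁
  have h₃ := congrArg rest h₂
  have h₁' := congrArg ones h
  have h₂' := congrArg ones h₁
  have h₃' := congrArg ones h₂
  simp only [withHeader, rest_replicate_append, ones_replicate_append] at h₃ h₁' h₂' h₃'
  exact ⟨h₁', h₂', h₃', h₃⟩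

/-! ### The marked pairs -/

variable {T : List Bool}

theorem Stage.pairHoming (j : ℕ) : ∀ (s t : Fin n), Stage n m k T j s t →
    (tableMachine n m k T).PairHoming s t := by
  induction j with
  | zero =>
    intro s t h
    obtain rfl := Fin.ext h
    exact .refl _
  | succ j ih =>
    rintro s t (h | ⟨i, hi, h⟩)
    · exact ih s t h
    · exact .step ⟨i, hi⟩ fun o u v hu hv => ih u v (h o o.2 u u.2 v v.2 hu hv)

-- Until the stages become closed under `Step`, each round adds a pair, so stage `j` has at least
-- `j` pairs. Hence stage `n * n` is closed or consists of all pairs, and then it is closed too.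
open Classical in
theorem stage_closed (s : ℕ) (hs : s < n) (t : ℕ) (ht : t < n)
    (h : Step n m k T (Stage n m k T (n * n)) s t) : Stage n m k T (n * n) s t := by
  let A (j : ℕ) : Finset (Fin n × Fin n) :=
    Finset.univ.filter fun p => Stage n m k T j p.1 p.2
  have key (j : ℕ) : (∀ s < n, ∀ t < n, Step n m k T (Stage n m k T j) s t →
      Stage n m k T j s t) ∨ j ≤ (A j).card := by
    induction j with
    | zero => exact Or.inr (Nat.zero_le _)
    | succ j ih =>
      by_cases hj : ∀ s < n, ∀ t < n, Step n m k T (Stage n m k T j) s t → Stage n m k T j s t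
      · refine Or.inl fun s hs t ht hst => Or.inr (hst.mono fun u hu v hv h => ?_)
        exact h.elim id (hj u hu v hv)
      · refine Or.inr (Nat.succ_le_of_lt ((ih.resolve_left hj).trans_lt (Finset.card_lt_card ?_)))
        push Not at hj
        obtain ⟨s, hs, t, ht, h, h'⟩ := hj
        rw [Finset.ssubset_iff_of_subset fun p hp => by
          simp only [A, Finset.mem_filter, Finset.mem_univ, true_and] at hp ⊢
          exact Or.inl hp]
        refine ⟨(⟨s, hs⟩, ⟨t, ht⟩), ?_, ?_⟩
        · simp only [A, Finset.mem_filter, Finset.mem_univ, true_and]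
          exact Or.inr h
        · simpa [A] using h'
  rcases key (n * n) with h' | h'
  · exact h' s hs t ht h
  · have : A (n * n) = Finset.univ := by
      rw [← Finset.card_eq_iff_eq_univ]
      refine le_antisymm (Finset.card_le_univ _) ?_
      simpa using h'
    have hmem : ((⟨s, hs⟩, ⟨t, ht⟩) : Fin n × Fin n) ∈ A (n * n) := by simp [this]
    simpa [A] using hmem

/-- `PairHoming` is the least relation containing the diagonal and closed under steps. Every stage
lies in it, and the stage `n * n`, being closed, contains it. -/
theorem stage_iff_pairHoming (s t : Fin n) :
    Stage n m k T (n * n) s t ↔ (tableMachine n m k T).PairHoming s t := by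
  refine ⟨Stage.pairHoming _ s t, fun h => ?_⟩
  have hrefl (j : ℕ) (u : ℕ) : Stage n m k T j u u := by
    induction j with
    | zero => rfl
    | succ j ih => exact Or.inl ih
  induction h with
  | refl s => exact hrefl _ _
  | @step s t i _ ih =>
    exact stage_closed s s.2 t t.2 ⟨i, i.2, fun o ho u hu v hv h₁ h₂ =>
      ih ⟨o, ho⟩ ⟨u, hu⟩ ⟨v, hv⟩ h₁ h₂⟩

end

/-! ### The language -/

/-- What is to be checked about a word. -/
def Accepted (w : List Bool) : Prop :=
  (closed w = true ∧ closed (rest w) = true ∧ closed (rest (rest w)) = true) ∧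
  (0 < states w ∧ 0 < inputs w ∧ 0 < outputs w) ∧
  (body w).length = states w * (inputs w * (outputs w * states w)) ∧
  (∀ s < states w, ∀ i < inputs w, ∃ o < outputs w, ∃ u < states w,
    transBit (states w) (inputs w) (outputs w) (body w) s i o u = true) ∧
  (∀ s < states w, ∀ i < inputs w, ∀ o < outputs w, ∀ u < states w, ∀ v < states w,
    transBit (states w) (inputs w) (outputs w) (body w) s i o u = true →
    transBit (states w) (inputs w) (outputs w) (body w) s i o v = true → u = v) ∧
  ∀ s < states w, ∀ t < states w,
    Stage (states w) (inputs w) (outputs w) (body w) (states w * states w) s t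

theorem complete_iff {n m k : ℕ} {T : List Bool} : (tableMachine n m k T).Complete ↔
    ∀ s < n, ∀ i < m, ∃ o < k, ∃ u < n, transBit n m k T s i o u = true := by
  constructor
  · intro h s hs i hi
    obtain ⟨o, u, hu⟩ := h ⟨s, hs⟩ ⟨i, hi⟩
    exact ⟨o, o.2, u, u.2, hu⟩
  · intro h s i
    obtain ⟨o, ho, u, hu, h⟩ := h s s.2 i i.2
    exact ⟨⟨o, ho⟩, ⟨u, hu⟩, h⟩

theorem observable_iff {n m k : ℕ} {T : List Bool} : (tableMachine n m k T).Observable ↔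
    ∀ s < n, ∀ i < m, ∀ o < k, ∀ u < n, ∀ v < n, transBit n m k T s i o u = true →
      transBit n m k T s i o v = true → u = v := by
  constructor
  · intro h s hs i hi o ho u hu v hv h₁ h₂
    exact congrArg Fin.val (h ⟨s, hs⟩ ⟨i, hi⟩ ⟨o, ho⟩ ⟨u, hu⟩ ⟨v, hv⟩ h₁ h₂)
  · intro h s i o u v h₁ h₂
    exact Fin.ext (h s s.2 i i.2 o o.2 u u.2 v v.2 h₁ h₂)

/-- Parsing inverts coding, and homing is reduced to pairs. Demanding `0 < states w` loses nothing,
since a machine without states is not homing. -/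
theorem mem_adaptiveHomingLanguage_iff (w : List Bool) :
    w ∈ FSM.adaptiveHomingLanguage ↔ Accepted w := by
  constructor
  · rintro ⟨n, m, k, M, hm, hk, hcomp, hobs, hhom, rfl⟩
    have : Nonempty (Fin n) := hhom.nonempty
    have : Nonempty (Fin k) := ⟨⟨0, hk⟩⟩
    have hn : 0 < n := Fin.pos_iff_nonempty.2 ‹_›
    have hM := tableMachine_table M
    rw [FSM.adaptivelyHoming_iff hobs] at hhom
    rw [← hM] at hcomp hobs hhom
    have h₁ : states M.code = n := by
      rw [code_eq, withHeader, states, ones_replicate_append]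
    have h₂ : inputs M.code = m := by
      rw [code_eq, withHeader, inputs, rest_replicate_append, ones_replicate_append]
    have h₃ : outputs M.code = k := by
      rw [code_eq, withHeader, outputs, rest_replicate_append, rest_replicate_append,
        ones_replicate_append]
    have h₄ : body M.code = table M := by
      rw [code_eq, withHeader, body, rest_replicate_append, rest_replicate_append,
        rest_replicate_append]
    refine ⟨⟨?_, ?_, ?_⟩, ?_⟩
    · rw [code_eq, withHeader, closed_replicate_append]
    · rw [code_eq, withHeader, rest_replicate_append, closed_replicate_append]
    · rw [code_eq, withHeader, rest_replicate_append, rest_replicate_append,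
        closed_replicate_append]
    · rw [h₁, h₂, h₃, h₄]
      exact ⟨⟨hn, hm, hk⟩, length_table M, complete_iff.1 hcomp, observable_iff.1 hobs,
        fun s hs t ht => (stage_iff_pairHoming ⟨s, hs⟩ ⟨t, ht⟩).2 (hhom _ _)⟩
  · rintro ⟨⟨h₁, h₂, h₃⟩, ⟨hn, hm, hk⟩, hlen, hcomp, hobs, hhom⟩
    have : Nonempty (Fin (states w)) := ⟨⟨0, hn⟩⟩
    have : Nonempty (Fin (outputs w)) := ⟨⟨0, hk⟩⟩
    refine ⟨_, _, _, tableMachine (states w) (inputs w) (outputs w) (body w), hm, hk,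
      complete_iff.2 hcomp, observable_iff.2 hobs, ?_, ?_⟩
    · rw [FSM.adaptivelyHoming_iff (observable_iff.2 hobs)]
      exact fun s t => (stage_iff_pairHoming s t).1 (hhom s s.2 t t.2)
    · rw [code_eq, table_tableMachine hlen, ← eq_withHeader h₁ h₂ h₃]

/-- Membership provides some homing machine with this code; as the code determines the machine, it
is `M`. -/
theorem code_mem_iff {n m k : ℕ} (M : FSM (Fin n) (Fin m) (Fin k)) (hm : 0 < m) (hk : 0 < k)
    (hcomp : M.Complete) (hobs : M.Observable) :
    M.code ∈ FSM.adaptiveHomingLanguage ↔ M.AdaptivelyHoming := by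
  constructor
  · rintro ⟨n', m', k', M', -, -, -, -, h, hcode⟩
    rw [code_eq, code_eq] at hcode
    obtain ⟨rfl, rfl, rfl, hT⟩ := withHeader_injective hcode
    rwa [← tableMachine_table M, ← hT, tableMachine_table]
  · exact fun h => ⟨n, m, k, M, hm, hk, hcomp, hobs, h, rfl⟩

/-! ### The decider -/

/-- Empty a stack. -/
def clear (k : Stack) : Prog := .seq (popTop k) (.loop hasTop (popTop k))

theorem runs_clear (k : Stack) (fl : Flag → Bool) (l : List Bool) :
    ∀ (c : Option Bool) (S : Stack → List Bool), S k = l →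
      Runs (clear k) ((c, fl), S) (2 * l.length + 2) ((none, fl), update S k []) := by
  have hloop : ∀ (l : List Bool) (S : Stack → List Bool), S k = l.tail →
      Runs (.loop hasTop (popTop k)) ((l.head?, fl), S) (2 * l.length + 1)
        ((none, fl), update S k []) := by
    intro l
    induction l with
    | nil =>
      intro S hS
      exact (runs_while_false _ _ _).of_eq (by rw [← hS.trans List.tail_nil, update_eq_self])
        (by omega)
    | cons x l ih =>
      intro S hS
      have h := runs_popTop k (some x) fl S
      rw [hS, List.tail_cons] at h
      refine (runs_while_true h (ih _ (by simp))).of_eq (by rw [update_idem]) ?_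
      simp only [List.length_cons]
      omega
  intro c S hS
  have h := runs_popTop k c fl S
  rw [hS] at h
  exact (h.seq (hloop l _ (by simp))).of_eq (by rw [update_idem]) (by omega)

/-- Empty the stacks in a list. -/
def clearAll : List Stack → Prog
  | [] => clearTop
  | k :: l => .seq (clear k) (clearAll l)

theorem runs_clearAll {N : ℕ} (fl : Flag → Bool) (l : List Stack) :
    ∀ (S : Stack → List Bool), (∀ k, (S k).length ≤ N) →
      Runs (clearAll l) ((none, fl), S) (l.length * (2 * N + 2) + 1)
        ((none, fl), fun k => if k ∈ l then [] else S k) := by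
  induction l with
  | nil => exact fun S _ => (runs_clearTop none fl S).of_eq (by simp) (by simp)
  | cons k l ih =>
    intro S hS
    refine ((runs_clear k fl _ none S rfl).seq (ih _ fun j => ?_)).of_eq ?_ ?_
    · by_cases hj : j = k
      · subst hj
        simp
      · simpa [hj] using hS j
    · refine Prod.ext rfl ?_
      ext1 j
      by_cases hj : j = k
      · subst hj
        simp
      · simp [hj]
    · have := hS k
      simp only [List.length_cons]
      ring_nf
      omega

/-- The part of the decider that follows the reading of the bounds. -/
noncomputable def mainProg : TimedProg :=
  (checkPositive .s).seq ((checkPositive .i).seq ((checkPositive .o).seq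
    (checkLength.seq (fillTables.seq checks))))

theorem triple_mainProg {n m k N : ℕ} {T : List Bool} (hN : IsBound n m k T N)
    (fl : Flag → Bool) :
    Triple N (dims n m k) 0 (· = ⟨fl, update (fun _ => []) .inp T⟩) mainProg
      (At n m k T fun fl' _ => fl' .ok = true ↔ fl .ok = true ∧ (0 < n ∧ 0 < m ∧ 0 < k) ∧
        T.length = n * (m * (k * n)) ∧
        (∀ s < n, ∀ i < m, ∃ o < k, ∃ u < n, transBit n m k T s i o u = true) ∧
        (∀ s < n, ∀ i < m, ∀ o < k, ∀ u < n, ∀ v < n, transBit n m k T s i o u = true →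
          transBit n m k T s i o v = true → u = v) ∧
        ∀ s < n, ∀ t < n, Stage n m k T (n * n) s t) := by
  refine (triple_checkPositive .s).seq ((triple_checkPositive .i).seq
    ((triple_checkPositive .o).seq ((triple_checkLength hN (by simp) (by simp)).seq
      ((triple_fillTables hN).seq ((triple_checks hN
        (fl .ok = true ∧ (0 < n ∧ 0 < m ∧ 0 < k) ∧ T.length = n * (m * (k * n)))
        stage_closed).weaken ?_ ?_)))))
  · rintro _ rfl
    refine ⟨_, List.length_replicate, rfl, ?_, fun u hu v hv => ?_⟩
    · simp only [update_self, Bool.and_eq_true, decide_eq_true_eq, and_assoc]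
      rfl
    · simp only [pairBit, List.getD_eq_getElem?_getD, List.getElem?_replicate]
      split_ifs <;> rfl
  · rintro μ ⟨H, hH, hD, h⟩
    refine ⟨H, hH, hD, ?_⟩
    simpa only [and_assoc] using h

/-- The decider as a program. -/
noncomputable def decider : Prog :=
  .seq (.load fun v => (none, update v.2 .ok true))
    (.seq (readBounds [.s, .t, .u, .v, .a, .b]) (.seq (readBounds [.i]) (.seq (readBounds [.o])
      (.seq mainProg.prog (.seq (clearAll Finset.univ.toList)
        (.seq (.push (.dat .out) fun v => v.2 .ok) (.load fun _ => (none, fun _ => false))))))))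

/-- The bound of the running time of the decider in terms of a bound of the heights of all
stacks. -/
noncomputable def deciderBound : ℕ[X] :=
  mainProg.bound + (C (Fintype.card Stack) * (2 * X + 2) + 17 * X + 20)

theorem ones_add_length_rest (w : List Bool) : ones w + (rest w).length ≤ w.length := by
  have := congrArg List.length (List.takeWhile_append_dropWhile (p := id) (l := w))
  rw [List.length_append] at this
  simp only [ones, rest, List.length_tail]
  omega

/-- The word need not be a code, so the length of its table does not control `m * (k * n)`. This is
a product of three numbers read from the word, whence the cube. -/
theorem isBound (w : List Bool) :
    IsBound (states w) (inputs w) (outputs w) (body w) ((w.length + 1) ^ 3) := by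
  have h₁ := ones_add_length_rest w
  have h₂ := ones_add_length_rest (rest w)
  have h₃ := ones_add_length_rest (rest (rest w))
  have hn : states w ≤ w.length + 1 := by unfold states; omega
  have hm : inputs w ≤ w.length + 1 := by unfold inputs; omega
  have hk : outputs w ≤ w.length + 1 := by unfold outputs; omega
  have hT : (body w).length ≤ w.length + 1 := by unfold body; omega
  have hpow (i : ℕ) (hi : i ≤ 3) : (w.length + 1) ^ i ≤ (w.length + 1) ^ 3 :=
    Nat.pow_le_pow_right (by omega) hi
  have hp₁ := hpow 1 (by omega)
  have hp₂ := hpow 2 (by omega)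
  rw [pow_one] at hp₁
  rw [pow_two] at hp₂
  have hkn := Nat.mul_le_mul hk hn
  refine ⟨Nat.one_le_pow _ _ (by omega), fun x => ?_, hkn.trans hp₂, ?_, hT.trans hp₁,
    (Nat.mul_le_mul hn hn).trans hp₂⟩
  · cases x <;> simp only [dims] <;> omega
  · rw [pow_succ', pow_two]
    exact Nat.mul_le_mul hm hkn

-- All checks run on every word, well-formed or not, and failures accumulate in `.ok`. Clearing the
-- stacks and resetting the registers produces the memory required of an output configuration.
open Classical in
theorem runs_decider (w : List Bool) :
    Runs decider ((none, fun _ => false), update (fun _ => []) (.dat .inp) w)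
      (deciderBound.eval ((w.length + 1) ^ 3))
      ((none, fun _ => false), update (fun _ => []) (.dat .out)
        [decide (w ∈ FSM.adaptiveHomingLanguage)]) := by
  have hN := isBound w
  set N := (w.length + 1) ^ 3 with hNdef
  have hwN : w.length ≤ N := by
    have : (w.length + 1) ^ 1 ≤ (w.length + 1) ^ 3 := Nat.pow_le_pow_right (by omega) (by omega)
    rw [pow_one] at this
    omega
  have h₁ := ones_add_length_rest w
  have h₂ := ones_add_length_rest (rest w)
  have hstart : update (fun _ => []) (.dat .inp) w =
      stk 0 0 (update (fun _ => []) .inp w) := by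
    rw [← update_stk_dat]
    refine congrArg (fun S : Stack → List Bool => update S (Stack.dat .inp) w) ?_
    ext1 k
    cases k <;> simp [stk]
  have hload := Runs.load (fun v : Reg => (none, update v.2 .ok true)) (none, fun _ => false)
    (update (fun _ => []) (Stack.dat .inp) w)
  rw [hstart] at hload
  have hr₁ := runs_readBounds [.s, .t, .u, .v, .a, .b] 0 (update (fun _ => false) .ok true)
    (update (fun _ => []) .inp w)
  have hr₂ := fun d b => runs_readBounds [.i] d (update (fun _ => false) .ok b)
    (update (fun _ => []) .inp (rest w))
  have hr₃ := fun d b => runs_readBounds [.o] d (update (fun _ => false) .ok b)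
    (update (fun _ => []) .inp (rest (rest w)))
  simp only [update_self, update_idem] at hr₁ hr₂ hr₃
  have hdims : (fun y => (((0 : Var → ℕ) y + ones w * [.s, .t, .u, .v, .a, .b].count y) +
      ones (rest w) * [Var.i].count y) + ones (rest (rest w)) * [Var.o].count y) =
      dims (states w) (inputs w) (outputs w) := by
    ext1 y
    cases y <;> simp [dims, states, inputs, outputs]
  have hr₃' := fun b => (hr₃ _ b).of_eq (congrArg (fun d => conf d 0 _) hdims) le_rfl
  obtain ⟨μ, ⟨H, hH, hD, hok⟩, hmain⟩ := triple_mainProg hN (update (fun _ => false) .ok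
    (((true && closed w) && closed (rest w)) && closed (rest (rest w)))) _ rfl
  have hheight (j : Stack) : (stk (dims (states w) (inputs w) (outputs w)) 0 μ.dat j).length ≤
      N := by
    cases j with
    | lo x => simp [stk]
    | hi x => simpa [stk] using hN.dims x
    | dat j =>
      have hn : states w ≤ N := hN.dims .s
      rw [hD]
      cases j <;> simp [stk, store, hH, hN.one, hN.strideI, hN.strideS, hN.table, hN.pairs, hn]
  have hanswer : μ.flag .ok = decide (w ∈ FSM.adaptiveHomingLanguage) := by
    rw [Bool.eq_iff_iff, hok, decide_eq_true_eq, mem_adaptiveHomingLanguage_iff, Accepted]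
    simp only [update_self, Bool.and_eq_true, Bool.true_and, and_assoc]
  have hempty := runs_clearAll μ.flag Finset.univ.toList _ hheight
  simp only [Finset.mem_toList, Finset.mem_univ, if_true, Finset.length_toList,
    Finset.card_univ] at hempty
  have hpush := Runs.push (Stack.dat .out) (fun v : Reg => v.2 .ok) (none, μ.flag) (fun _ => [])
  have hreset := Runs.load (fun _ : Reg => (none, fun _ => false)) (none, μ.flag)
    (update (fun _ => []) (Stack.dat .out) [decide (w ∈ FSM.adaptiveHomingLanguage)])
  simp only [hanswer] at hpush
  rw [hstart]
  refine (hload.seq (hr₁.seq ((hr₂ _ _).seq ((hr₃' _).seq (hmain.seq (hempty.seq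
    (hpush.seq hreset))))))).mono ?_
  -- Reading the three numbers costs 9, 4 and 4 steps per bit, together the 17 in `deciderBound`.
  simp only [deciderBound, List.length_cons, List.length_nil, eval_add, eval_mul, eval_C, eval_X,
    eval_ofNat]
  omega

open Classical in
/-- The decider as a Turing machine with a polynomial bound of its running time. -/
noncomputable def polyTimeDecider : PolyTimeDecider FSM.adaptiveHomingLanguage where
  tm := decider.machine (.dat .inp) (.dat .out) (none, fun _ => false)
  inputAlphabet := Equiv.refl Bool
  outputAlphabet := Equiv.refl Bool
  time := deciderBound.comp ((X + 1) ^ 3) + 1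
  outputsFun w := Classical.choice <| by
    have h : ∀ l : List Bool, l = w → Nonempty (TM2OutputsInTime
        (decider.machine (.dat .inp) (.dat .out) (none, fun _ => false)) l
        (some [decide (w ∈ FSM.adaptiveHomingLanguage)])
        ((deciderBound.comp ((X + 1) ^ 3) + 1).eval w.length)) := by
      rintro _ rfl
      rw [eval_add, eval_comp, eval_pow, eval_add, eval_X, eval_one]
      exact (runs_decider _).outputsInTime
    exact h _ (List.map_id w)

theorem eval_mono (p : ℕ[X]) : Monotone fun x => p.eval x := fun x y hxy => by
  dsimp only
  rw [eval_eq_sum, eval_eq_sum]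
  exact Finset.sum_le_sum fun i _ => Nat.mul_le_mul_left _ (Nat.pow_le_pow_left hxy i)

theorem length_code {n m k : ℕ} (M : FSM (Fin n) (Fin m) (Fin k)) :
    M.code.length = n + m + k + 3 + n * (m * (k * n)) := by
  simp only [code_eq, withHeader, List.length_append, List.length_replicate, List.length_cons,
    length_table]
  ring

end HomingMachine

open HomingMachine Polynomial in
/-- Existence of a homing test case for a complete observable machine is decidable in polynomial
time: the corresponding language is in P, and the decider runs in time polynomial in the number
of states alone on machines whose numbers of inputs and outputs are polynomially bounded in the
number of states. -/
theorem proposition5 :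
    ∃ A : PolyTimeDecider FSM.adaptiveHomingLanguage,
      ∀ q : Polynomial ℕ, ∃ r : Polynomial ℕ,
        ∀ (n m k : ℕ) (M : FSM (Fin n) (Fin m) (Fin k)), 0 < m → 0 < k →
          M.Complete → M.Observable → m ≤ q.eval n → k ≤ q.eval n →
            AnswersInTime A.toTM2ComputableAux M.code M.AdaptivelyHoming (r.eval n) := by
  -- The inner polynomial bounds the length `n + m + k + 3 + n * (m * (k * n))` of the code when `m`
  -- and `k` are at most `q.eval n`.
  refine ⟨polyTimeDecider, fun q => ⟨polyTimeDecider.time.comp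
    (X + q + q + 3 + X * (q * (q * X))), fun n m k M hm hk hcomp hobs hmq hkq => ?_⟩⟩
  have h := polyTimeDecider.outputsFun M.code
  beta_reduce at h
  -- For the code of a complete observable machine, the bit deciding membership is the bit deciding
  -- the homing property.
  rw [decide_eq_decide.2 (code_mem_iff M hm hk hcomp hobs)] at h
  refine ⟨{ h with steps_le_m := h.steps_le_m.trans ?_ }⟩
  rw [eval_comp]
  refine eval_mono _ ?_
  simp only [id, length_code, eval_add, eval_mul, eval_X, eval_ofNat]
  gcongr
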